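/- Let $q$ be a prime power and let $n,l,m$ be integers with $1<m<n-1$ and $l>0$. Let $E$ be the subspace of $\mathbb F_q^{\,n+l}$ spanned by the last $l$ standard basis vectors $e_{n+1},\dots,e_{n+l}$. Let $X_m$ be the set of all $m$-dimensional subspaces $P$ of $\mathbb F_q^{\,n+l}$ with $P\cap E=0$ (the subspaces of type $(m,0)$), and for $P\in X_m$ let $P'\subseteq\mathbb F_q^{\,n}$ be the image of $P$ under the projection onto the first $n$ coordinates. For $0\le i\le\min\{m,n-m\}$ and $0\le j-i\le\min\{m-i,j,l\}$ put $$R_{i,j-i}=\{(P,Q)\in X_m\times X_m : \dim(P'\cap Q')=m-i,\ \dim(P\cap Q)=m-j\}.$$ These relations form a symmetric association scheme $\mathfrak X_m$ on $X_m$. Let $\mathrm{Aut}(\mathfrak X_m)$ be its full automorphism group, that is, the group of all permutations $\sigma$ of $X_m$ for which there is a permutation $\bar\sigma$ of the set of indices of the relations such that $\sigma$ carries each relation $R_{\alpha}$ onto $R_{\bar\sigma(\alpha)}$. Let $P\Gamma L(n+l,\mathbb F_q)$ be the group of all bijective semilinear maps of $\mathbb F_q^{\,n+l}$ modulo the nonzero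 scalar maps, and let $P\Gamma L(n+l,\mathbb F_q)_E$ be the stabilizer of $E$ in it, which acts on $X_m$ by taking images of subspaces. Then $$\mathrm{Aut}(\mathfrak X_m)=P\Gamma L(n+l,\mathbb F_q)_E$$ as permutation groups on $X_m$: the action of $P\Gamma L(n+l,\mathbb F_q)_E$ on $X_m$ is faithful, and the permutations of $X_m$ that it induces are exactly the automorphisms of $\mathfrak X_m$. -/

import Mathlib

namespace AttenuatedSpace

section SemilinearGroup

variable (F : Type*) [Field F] (V : Type*) [AddCommGroup V] [Module F V]

/-- The general semilinear group of `V`: all additive bijections `g` of `V` such that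
`g (c • v) = σ c • g v` for some field automorphism `σ` of `F`. The product is composition. -/
def GammaL : Subgroup (Equiv.Perm V) where
  carrier := {g | (∀ u v : V, g (u + v) = g u + g v) ∧
    ∃ σ : F ≃+* F, ∀ (c : F) (v : V), g (c • v) = σ c • g v}
  one_mem' := ⟨fun _ _ => rfl, RingEquiv.refl F, fun _ _ => rfl⟩
  mul_mem' := by
    rintro g h ⟨hg, σ, hσ⟩ ⟨hh, τ, hτ⟩
    exact ⟨fun u v => by simp [hg, hh], τ.trans σ, fun c v => by simp [hτ, hσ]⟩
  inv_mem' := by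
    rintro g ⟨hg, σ, hσ⟩
    refine ⟨fun u v => ?_, σ.symm, fun c v => ?_⟩
    · apply g.injective
      rw [hg]
      simp
    · apply g.injective
      rw [hσ]
      simp

/-- The subgroup of nonzero scalar maps `v ↦ c • v`. -/
def scalars : Subgroup (GammaL F V) where
  carrier := {g | ∃ c : Fˣ, ∀ v : V, (g : Equiv.Perm V) v = (c : F) • v}
  one_mem' := ⟨1, fun v => by simp⟩
  mul_mem' := by
    rintro g h ⟨c, hc⟩ ⟨d, hd⟩
    exact ⟨c * d, fun v => by simp [hc, hd, mul_smul]⟩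
  inv_mem' := by
    rintro g ⟨c, hc⟩
    refine ⟨c⁻¹, fun v => ?_⟩
    apply (g : Equiv.Perm V).injective
    rw [hc (_ • v)]
    simp

instance scalars_normal : (scalars F V).Normal where
  conj_mem := by
    rintro h ⟨c, hc⟩ g
    obtain ⟨_, σ, hσ⟩ := g.2
    refine ⟨Units.map σ.toMonoidHom c, fun v => ?_⟩
    simp [hc, hσ]

/-- The projective semilinear group of `V`: the semilinear group modulo the scalar maps. -/
def PGammaL : Type _ := GammaL F V ⧸ scalars F V

instance instGroupPGammaL : Group (PGammaL F V) := inferInstanceAs (Group (GammaL F V ⧸ scalars F V))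

variable {F V}

/-- The image of a subspace under a semilinear bijection. -/
def mapSubspace (g : GammaL F V) (P : Submodule F V) : Submodule F V where
  carrier := (g : Equiv.Perm V) '' (P : Set V)
  zero_mem' := ⟨0, P.zero_mem, by simpa using g.2.1 0 0⟩
  add_mem' := by
    rintro _ _ ⟨x, hx, rfl⟩ ⟨y, hy, rfl⟩
    exact ⟨x + y, P.add_mem hx hy, g.2.1 x y⟩
  smul_mem' := by
    rintro c _ ⟨x, hx, rfl⟩
    obtain ⟨_, σ, hσ⟩ := g.2
    exact ⟨σ.symm c • x, P.smul_mem _ hx, by simp [hσ]⟩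

theorem coe_mapSubspace (g : GammaL F V) (P : Submodule F V) :
    (mapSubspace g P : Set V) = (g : Equiv.Perm V) '' (P : Set V) := rfl

/-- The semilinear group acts on subspaces by taking images. -/
instance instMulActionGammaL : MulAction (GammaL F V) (Submodule F V) where
  smul := mapSubspace
  one_smul P := SetLike.coe_injective (by
    change ((1 : GammaL F V) : Equiv.Perm V) '' (P : Set V) = P
    simp)
  mul_smul g h P := SetLike.coe_injective (by
    change ((g * h : GammaL F V) : Equiv.Perm V) '' (P : Set V)
      = (g : Equiv.Perm V) '' ((h : Equiv.Perm V) '' (P : Set V))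
    rw [Set.image_image]
    rfl)

theorem coe_smul (g : GammaL F V) (P : Submodule F V) :
    ((g • P : Submodule F V) : Set V) = (g : Equiv.Perm V) '' (P : Set V) := rfl

theorem scalars_smul (g : GammaL F V) (hg : g ∈ scalars F V) (P : Submodule F V) :
    g • P = P := by
  obtain ⟨c, hc⟩ := hg
  ext v
  rw [← SetLike.mem_coe, coe_smul]
  constructor
  · rintro ⟨x, hx, rfl⟩
    rw [hc]
    exact P.smul_mem _ hx
  · intro hv
    exact ⟨(c⁻¹ : F) • v, P.smul_mem _ hv, by simp [hc]⟩

/-- The action of the projective semilinear group on subspaces, induced by that of the semilinear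
group (scalar maps act trivially). -/
def subspacePerm : PGammaL F V →* Equiv.Perm (Submodule F V) :=
  QuotientGroup.lift (scalars F V) (MulAction.toPermHom (GammaL F V) (Submodule F V))
    (fun g hg => Equiv.ext fun P => scalars_smul g hg P)

instance instMulActionPGammaL : MulAction (PGammaL F V) (Submodule F V) :=
  MulAction.compHom _ (subspacePerm (F := F) (V := V))

theorem exists_rep (g : PGammaL F V) :
    ∃ h : GammaL F V, ∀ P : Submodule F V, g • P = h • P := by
  obtain ⟨h, rfl⟩ := QuotientGroup.mk_surjective g
  exact ⟨h, fun _ => rfl⟩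

theorem finrank_smul (g : PGammaL F V) (P : Submodule F V) :
    Module.finrank F (g • P : Submodule F V) = Module.finrank F P := by
  obtain ⟨h, hh⟩ := exists_rep g
  rw [hh]
  obtain ⟨hadd, σ, hσ⟩ := h.2
  let e : P ≃+ (h • P : Submodule F V) :=
    { Equiv.Set.image (h : Equiv.Perm V) (P : Set V) (h : Equiv.Perm V).injective with
      map_add' := fun x y => Subtype.ext (hadd (x : V) y) }
  have := rank_eq_of_equiv_equiv σ e σ.bijective
    (fun c x => Subtype.ext (hσ c (x : V)))
  simp only [Module.finrank, this]

theorem smul_inf (g : PGammaL F V) (P Q : Submodule F V) :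
    g • (P ⊓ Q) = g • P ⊓ g • Q := by
  obtain ⟨h, hh⟩ := exists_rep g
  rw [hh, hh, hh]
  apply SetLike.coe_injective
  rw [Submodule.coe_inf, coe_smul, coe_smul, coe_smul, Submodule.coe_inf]
  exact Set.image_inter (h : Equiv.Perm V).injective

end SemilinearGroup

section Scheme

/-- The full automorphism group of a configuration `(X, {R i})`: the permutations `σ` of `X` for
which there is a permutation `π` of the index set such that `σ` carries `R i` onto `R (π i)` for
every `i`. When the `R i` partition `X × X`, it is the same to ask that
`R i x y` implies `R (π i) (σ x) (σ y)`. -/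
def schemeAut {X I : Type*} (R : I → X → X → Prop) : Subgroup (Equiv.Perm X) where
  carrier := {σ | ∃ π : Equiv.Perm I, ∀ i x y, R i x y ↔ R (π i) (σ x) (σ y)}
  one_mem' := ⟨1, fun _ _ _ => Iff.rfl⟩
  mul_mem' := by
    rintro σ τ ⟨π, hπ⟩ ⟨ρ, hρ⟩
    exact ⟨π * ρ, fun i x y => (hρ i x y).trans (hπ _ _ _)⟩
  inv_mem' := by
    rintro σ ⟨π, hπ⟩
    exact ⟨π⁻¹, fun i x y => by simpa using (hπ (π⁻¹ i) (σ⁻¹ x) (σ⁻¹ y)).symm⟩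

variable (F : Type*) [Field F] (n l m : ℕ)

/-- The subspace `E` spanned by the last `l` standard basis vectors of `F ^ (n + l)`. -/
def E : Submodule F (Fin (n + l) → F) :=
  Submodule.span F (Set.range fun i : Fin l => Pi.single (Fin.natAdd n i) (1 : F))

variable {F n l} in
/-- `P` is a subspace of type `(m, k)`. -/
def IsType (m k : ℕ) (P : Submodule F (Fin (n + l) → F)) : Prop :=
  Module.finrank F P = m ∧ Module.finrank F (P ⊓ E F n l : Submodule F (Fin (n + l) → F)) = k

/-- The set `X_m` of all subspaces of type `(m, 0)`. -/
def Vertex : Type _ := {P : Submodule F (Fin (n + l) → F) // IsType m 0 P}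

variable {F n l} in
/-- The subspace `P'` of `F ^ n` obtained from `P` by keeping the first `n` coordinates
of its vectors. -/
def front (P : Submodule F (Fin (n + l) → F)) : Submodule F (Fin n → F) :=
  P.map (LinearMap.funLeft F F (Fin.castAdd l))

/-- The pairs `(i, j)` for which the relation `R_{i, j - i}` is part of the scheme. -/
def Index : Type :=
  {p : ℕ × ℕ // p.1 ≤ min m (n - m) ∧ p.1 ≤ p.2 ∧ p.2 - p.1 ≤ min (m - p.1) (min p.2 l)}

/-- The relation `R_{i, j - i}`: `dim (P' ∩ Q') = m - i` and `dim (P ∩ Q) = m - j`. -/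
def rel (p : Index n l m) (P Q : Vertex F n l m) : Prop :=
  Module.finrank F (front P.1 ⊓ front Q.1 : Submodule F (Fin n → F)) + p.1.1 = m ∧
    Module.finrank F (P.1 ⊓ Q.1 : Submodule F (Fin (n + l) → F)) + p.1.2 = m

/-- The stabilizer of `E` in the projective semilinear group of `F ^ (n + l)`. -/
abbrev PGammaLStab : Subgroup (PGammaL F (Fin (n + l) → F)) :=
  MulAction.stabilizer (PGammaL F (Fin (n + l) → F)) (E F n l)

variable {F n l} in
theorem IsType.smul {m k : ℕ} (g : PGammaLStab F n l) {P : Submodule F (Fin (n + l) → F)}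
    (hP : IsType m k P) : IsType m k (g.1 • P) := by
  refine ⟨(finrank_smul g.1 P).trans hP.1, ?_⟩
  have hE : g.1 • E F n l = E F n l := g.2
  rw [← hP.2, ← finrank_smul g.1 (P ⊓ E F n l), smul_inf, hE]

/-- The stabilizer of `E` acts on `X_m` by taking images of subspaces. -/
instance instMulActionVertex : MulAction (PGammaLStab F n l) (Vertex F n l m) where
  smul g P := ⟨g.1 • P.1, P.2.smul g⟩
  one_smul P := Subtype.ext (one_smul _ P.1)
  mul_smul g h P := Subtype.ext (mul_smul g.1 h.1 P.1)

end Scheme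

end AttenuatedSpace

/-!
Up to reindexing, the relation of `P` and `Q` is their color `(dim (P ∩ (Q + E)), dim (P ∩ Q))`, so
the automorphisms are the permutations that respect equality of colors. The fibers of `P ↦ P + E`
are permuted by the automorphisms, because an equivalence relation that is a union of colors and
relates two subspaces of distinct fibers relates everything. Subspaces `P` and `Q` of distinct
fibers that share a hyperplane are then characterized through their twins, the `A` in the fiber of
`P` with the same color to `Q` as `P`: the set of twins of such a pair is as small as possible.
Hence automorphisms preserve this adjacency.

The subspaces that contain the common hyperplane of an adjacent pair can be recognized from
adjacency and fibers. So an automorphism in dimension `m` induces a permutation in dimension `m - 1`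
with the same properties, and finally a permutation of the points outside `E` that preserves the
lines not meeting `E`. The fundamental theorem of projective geometry, in a version for the points
outside `E`, lifts it to a semilinear map. This map stabilizes `E` and induces the given
automorphism.

A semilinear map that fixes every vertex fixes every line `⟨v⟩` with `v ∉ E`, because this line is
an intersection of vertices. It is therefore a scalar map.
-/

namespace AttenuatedSpace

open Module Submodule

section Hyperplane

variable {F V : Type*} [Field F] [AddCommGroup V] [Module F V] {A D E H P Q : Submodule F V} {x : V}

theorem sup_span_singleton_inf (hx : x ∉ H ⊔ A) : (H ⊔ span F {x}) ⊓ A = H ⊓ A := by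
  refine le_antisymm (le_inf ?_ inf_le_right) (inf_le_inf_right A le_sup_left)
  calc (H ⊔ span F {x}) ⊓ A ≤ (H ⊔ span F {x}) ⊓ (H ⊔ A) := inf_le_inf_left _ le_sup_right
    _ = H ⊔ span F {x} ⊓ (H ⊔ A) := sup_inf_assoc_of_le _ le_sup_left
    _ = H := by rw [(disjoint_span_singleton_of_notMem hx).symm.eq_bot, sup_bot_eq]

theorem sup_span_singleton_inf_of_le (h : H ≤ A) (hx : x ∉ A) : (H ⊔ span F {x}) ⊓ A = H := by
  rw [sup_span_singleton_inf (by rwa [sup_eq_right.2 h]), inf_eq_left.2 h]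

theorem inf_sup_sup_eq (P Q E : Submodule F V) : P ⊓ (Q ⊔ E) ⊔ E = (P ⊔ E) ⊓ (Q ⊔ E) := by
  rw [sup_comm P, sup_inf_assoc_of_le P (le_sup_right : E ≤ Q ⊔ E), sup_comm E]

theorem sup_inf_eq_of_le_of_disjoint (hH : H ≤ P) (hP : Disjoint P E) : (H ⊔ E) ⊓ P = H := by
  rw [sup_inf_assoc_of_le E hH, hP.symm.eq_bot, sup_bot_eq]

variable [FiniteDimensional F V]

theorem finrank_sup_of_disjoint (h : Disjoint P Q) :
    finrank F ↥(P ⊔ Q) = finrank F P + finrank F Q := by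
  have := finrank_sup_add_finrank_inf_eq P Q
  rwa [h.eq_bot, finrank_bot, add_zero] at this

theorem finrank_inf_sup_le (P Q E : Submodule F V) :
    finrank F ↥(P ⊓ (Q ⊔ E)) ≤ finrank F ↥(P ⊓ Q) + finrank F E := by
  have hsup_inf := finrank_sup_add_finrank_inf_eq (P ⊓ (Q ⊔ E)) Q
  rw [inf_assoc, inf_eq_right.2 (le_sup_left : Q ≤ Q ⊔ E)] at hsup_inf
  have hsup : finrank F ↥(P ⊓ (Q ⊔ E) ⊔ Q) ≤ finrank F Q + finrank F E :=
    (finrank_mono (sup_le inf_le_right le_sup_left)).trans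
      (finrank_add_le_finrank_add_finrank Q E)
  omega

theorem exists_mem_notMem_of_finrank_lt (h : finrank F P < finrank F Q) : ∃ x ∈ Q, x ∉ P :=
  SetLike.not_le_iff_exists.1 fun hle => h.not_ge (finrank_mono hle)

theorem exists_hyperplane_notMem (hD : D ≤ P) (hx : x ∈ P) (hxD : x ∉ D) :
    ∃ H, D ≤ H ∧ H ≤ P ∧ x ∉ H ∧ finrank F H + 1 = finrank F P := by
  obtain ⟨f, hfx, hf⟩ := exists_le_ker_of_notMem hxD
  refine ⟨P ⊓ LinearMap.ker f, le_inf hD hf, inf_le_left, fun h => hfx h.2, ?_⟩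
  have hsup : P ⊓ LinearMap.ker f ⊔ span F {x} = P := by
    refine le_antisymm (sup_le inf_le_left (by simpa using hx)) fun p hp => ?_
    rw [← sub_add_cancel p ((f p / f x) • x)]
    exact add_mem (mem_sup_left ⟨sub_mem hp (smul_mem _ _ hx), by simp [hfx]⟩)
      (mem_sup_right (smul_mem _ _ (mem_span_singleton_self x)))
  rw [← finrank_sup_span_singleton fun h : x ∈ P ⊓ LinearMap.ker f => hfx h.2, hsup]

end Hyperplane

section Transversal

variable {F V : Type*} [Field F] [AddCommGroup V] [Module F V]

/-- `P` has dimension `m` and meets `E` trivially: the coordinate-free version of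
type `(m, 0)`. -/
structure IsTransversal (E : Submodule F V) (m : ℕ) (P : Submodule F V) : Prop where
  finrank_eq : finrank F P = m
  disjoint : Disjoint P E

/-- The `m`-dimensional subspaces that meet `E` trivially: the vertices of the scheme. -/
abbrev Transversal (E : Submodule F V) (m : ℕ) : Type _ :=
  {P : Submodule F V // IsTransversal E m P}

/-- The dimensions of `P ∩ (Q + E)` and `P ∩ Q`. The first equals `dim (P' ∩ Q')`, so that the
color of a pair determines, and is determined by, the relation of the scheme it belongs to. -/
noncomputable def color (E P Q : Submodule F V) : ℕ × ℕ :=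
  (finrank F ↥(P ⊓ (Q ⊔ E)), finrank F ↥(P ⊓ Q))

variable {E P Q R S H : Submodule F V} {m : ℕ} {x e : V}

theorem color_eq_iff : color E P Q = color E R S ↔
    finrank F ↥(P ⊓ (Q ⊔ E)) = finrank F ↥(R ⊓ (S ⊔ E)) ∧
      finrank F ↥(P ⊓ Q) = finrank F ↥(R ⊓ S) := Prod.ext_iff

theorem color_eq_of_inf_sup_eq (h : P ⊓ (Q ⊔ E) = R ⊓ (Q ⊔ E)) : color E P Q = color E R Q := by
  have inf_eq (A : Submodule F V) : A ⊓ Q = A ⊓ (Q ⊔ E) ⊓ Q := by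
    rw [inf_assoc, inf_eq_right.2 (le_sup_left : Q ≤ Q ⊔ E)]
  rw [color, color, h, inf_eq P, h, ← inf_eq]

theorem IsTransversal.eq_zero (hP : IsTransversal E m P) (hx : x ∈ P) (hxE : x ∈ E) : x = 0 :=
  disjoint_def.1 hP.disjoint x hx hxE

theorem IsTransversal.mono (hP : IsTransversal E m P) (hH : H ≤ P) :
    IsTransversal E (finrank F H) H :=
  ⟨rfl, hP.disjoint.mono_left hH⟩

theorem IsTransversal.add_notMem_sup (hP : IsTransversal E m P) (hH : H ≤ P) (hx : x ∈ P)
    (hxH : x ∉ H) (he : e ∈ E) : x + e ∉ H ⊔ E := fun h => hxH <| by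
  rw [← sup_inf_eq_of_le_of_disjoint hH hP.disjoint]
  exact ⟨by simpa using sub_mem h (mem_sup_right he), hx⟩

variable [FiniteDimensional F V]

theorem IsTransversal.finrank_sup (hP : IsTransversal E m P) :
    finrank F ↥(P ⊔ E) = m + finrank F E := by
  rw [finrank_sup_of_disjoint hP.disjoint, hP.finrank_eq]

theorem IsTransversal.sup_span_singleton (hP : IsTransversal E m P) (hx : x ∉ P ⊔ E) :
    IsTransversal E (m + 1) (P ⊔ span F {x}) where
  finrank_eq := by
    rw [finrank_sup_span_singleton fun h => hx (mem_sup_left h), hP.finrank_eq]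
  disjoint := by rw [disjoint_iff, sup_span_singleton_inf hx, hP.disjoint.eq_bot]

theorem IsTransversal.exchange (hP : IsTransversal E m P) (hHP : H ≤ P)
    (hH : finrank F H + 1 = m) (hx : x ∉ H ⊔ E) : IsTransversal E m (H ⊔ span F {x}) :=
  hH ▸ (hP.mono hHP).sup_span_singleton hx

theorem IsTransversal.exists_hyperplane_notMem {D : Submodule F V} (hP : IsTransversal E m P)
    (hD : D ≤ P) (hx : x ∈ P) (hxD : x ∉ D) :
    ∃ H, D ≤ H ∧ H ≤ P ∧ x ∉ H ∧ finrank F H + 1 = m :=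
  hP.finrank_eq ▸ AttenuatedSpace.exists_hyperplane_notMem hD hx hxD

theorem IsTransversal.eq_of_le (hP : IsTransversal E m P) (hQ : IsTransversal E m Q)
    (h : P ≤ Q) : P = Q :=
  Submodule.eq_of_le_of_finrank_eq h (hP.finrank_eq.trans hQ.finrank_eq.symm)

theorem IsTransversal.sup_eq_of_le_sup (hP : IsTransversal E m P) (hQ : IsTransversal E m Q)
    (h : P ≤ Q ⊔ E) : P ⊔ E = Q ⊔ E :=
  Submodule.eq_of_le_of_finrank_eq (sup_le h le_sup_right)
    (hP.finrank_sup.trans hQ.finrank_sup.symm)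

theorem finrank_sup_inf_sup (hP : Disjoint P E) :
    finrank F ↥((P ⊔ E) ⊓ (Q ⊔ E)) = finrank F ↥(P ⊓ (Q ⊔ E)) + finrank F E := by
  rw [← inf_sup_sup_eq, finrank_sup_of_disjoint (hP.mono_left inf_le_left)]

theorem exists_exchange_vectors (hP : IsTransversal E m P) (hQ : IsTransversal E m Q)
    (hPQ : P ≠ Q) :
    ∃ p ∈ P, p ∉ Q ∧ ∃ q ∈ Q, q ∉ P ∧ ∀ H ≤ P, p ∉ H → q ∉ H ⊔ E := by
  by_cases hQP : Q ≤ P ⊔ E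
  · obtain ⟨q, hq, hqP⟩ := SetLike.not_le_iff_exists.1 fun h => hPQ (hQ.eq_of_le hP h).symm
    obtain ⟨p, hp, e, he, rfl⟩ := mem_sup.1 (hQP hq)
    refine ⟨p, hp, fun hpQ => hqP ?_, _, hq, hqP, fun H hH hpH => hP.add_notMem_sup hH hp hpH he⟩
    have he0 : e = 0 := hQ.eq_zero (by simpa using sub_mem hq hpQ) he
    simpa [he0] using hp
  · obtain ⟨q, hq, hqP⟩ := SetLike.not_le_iff_exists.1 hQP
    obtain ⟨p, hp, hpQ⟩ := SetLike.not_le_iff_exists.1 fun h => hPQ (hP.eq_of_le hQ h)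
    exact ⟨p, hp, hpQ, q, hq, fun h => hqP (mem_sup_left h),
      fun H hH _ h => hqP (sup_le_sup_right hH E h)⟩

theorem exists_meet_in_hyperplane_finrank_inf_lt (hP : IsTransversal E m P)
    (hQ : IsTransversal E m Q) (hPQ : P ≠ Q) :
    ∃ R, IsTransversal E m R ∧ finrank F ↥(P ⊓ R) + 1 = m ∧
      finrank F ↥(P ⊓ Q) < finrank F ↥(R ⊓ Q) := by
  obtain ⟨p, hp, hpQ, q, hq, hqP, hpq⟩ := exists_exchange_vectors hP hQ hPQ
  obtain ⟨H, hPQH, hHP, hpH, hH⟩ := hP.exists_hyperplane_notMem inf_le_left hp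
    (fun h : p ∈ P ⊓ Q => hpQ h.2)
  refine ⟨_, hP.exchange hHP hH (hpq H hHP hpH), ?_, ?_⟩
  · rw [inf_comm, sup_span_singleton_inf_of_le hHP hqP, hH]
  · rw [← Nat.add_one_le_iff, ← finrank_sup_span_singleton fun h : q ∈ P ⊓ Q => hqP h.1]
    exact finrank_mono (sup_le (le_inf (hPQH.trans le_sup_left) inf_le_right)
      ((span_singleton_le_iff_mem _ _).2 ⟨mem_sup_right (mem_span_singleton_self q), hq⟩))

end Transversal

section Fiber

variable {F V : Type*} [Field F] [AddCommGroup V] [Module F V] {E : Submodule F V} {m : ℕ}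

/-- `P` and `Q` have the same image modulo `E`, that is, `P' = Q'`. -/
def SameFiber (P Q : Transversal E m) : Prop := P.1 ⊔ E = Q.1 ⊔ E

/-- `P` and `Q` are distinct and share a hyperplane. -/
def MeetInHyperplane (P Q : Transversal E m) : Prop := finrank F ↥(P.1 ⊓ Q.1) + 1 = m

/-- `P` and `Q` share a hyperplane and have distinct images modulo `E`. -/
def Adj (P Q : Transversal E m) : Prop := MeetInHyperplane P Q ∧ ¬ SameFiber P Q

/-- `σ` respects equality of colors; these permutations are the automorphisms of the scheme. -/
def PermutesColors (σ : Equiv.Perm (Transversal E m)) : Prop :=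
  ∀ P Q R S, color E P.1 Q.1 = color E R.1 S.1 ↔
    color E (σ P).1 (σ Q).1 = color E (σ R).1 (σ S).1

variable {P Q R S : Transversal E m} {W : Submodule F V}

theorem SameFiber.symm (h : SameFiber P Q) : SameFiber Q P := Eq.symm h

theorem SameFiber.trans (h : SameFiber P Q) (h' : SameFiber Q R) : SameFiber P R := Eq.trans h h'

theorem sameFiber_equivalence : Equivalence (SameFiber (E := E) (m := m)) :=
  ⟨fun _ => rfl, SameFiber.symm, SameFiber.trans⟩

theorem MeetInHyperplane.symm (h : MeetInHyperplane P Q) : MeetInHyperplane Q P := by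
  rwa [MeetInHyperplane, inf_comm]

theorem Adj.symm (h : Adj P Q) : Adj Q P := ⟨h.1.symm, fun hQP => h.2 hQP.symm⟩

theorem PermutesColors.symm {σ : Equiv.Perm (Transversal E m)} (hσ : PermutesColors σ) :
    PermutesColors σ.symm := fun P Q R S => by
  simpa using (hσ (σ.symm P) (σ.symm Q) (σ.symm R) (σ.symm S)).symm

variable [FiniteDimensional F V]

theorem sameFiber_iff_le : SameFiber P Q ↔ P.1 ≤ Q.1 ⊔ E :=
  ⟨fun h => le_sup_left.trans h.le, P.2.sup_eq_of_le_sup Q.2⟩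

theorem sameFiber_iff_finrank_inf_sup : SameFiber P Q ↔ finrank F ↥(P.1 ⊓ (Q.1 ⊔ E)) = m := by
  rw [sameFiber_iff_le, ← inf_eq_left]
  constructor
  · intro h
    rw [h, P.2.finrank_eq]
  · intro h
    exact Submodule.eq_of_le_of_finrank_eq inf_le_left (h.trans P.2.finrank_eq.symm)

theorem sameFiber_iff_of_color_eq (h : color E P.1 Q.1 = color E R.1 S.1) :
    SameFiber P Q ↔ SameFiber R S := by
  rw [sameFiber_iff_finrank_inf_sup, sameFiber_iff_finrank_inf_sup, (color_eq_iff.1 h).1]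

theorem finrank_inf_sup_add_one_le (h : ¬ SameFiber P Q) :
    finrank F ↥(P.1 ⊓ (Q.1 ⊔ E)) + 1 ≤ m := by
  have hle : finrank F ↥(P.1 ⊓ (Q.1 ⊔ E)) ≤ m :=
    (finrank_mono inf_le_left).trans P.2.finrank_eq.le
  have hne := mt sameFiber_iff_finrank_inf_sup.2 h
  omega

theorem finrank_inf_lt (hPQ : P ≠ Q) : finrank F ↥(P.1 ⊓ Q.1) < m :=
  (finrank_lt_finrank_of_lt <| inf_lt_left.2 fun h =>
    hPQ (Subtype.ext (P.2.eq_of_le Q.2 h))).trans_eq P.2.finrank_eq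

theorem meetInHyperplane_of_le (hP : W ≤ P.1) (hQ : W ≤ Q.1) (hW : finrank F W + 1 = m)
    (hPQ : P ≠ Q) : MeetInHyperplane P Q := by
  have hge : finrank F W ≤ finrank F ↥(P.1 ⊓ Q.1) := finrank_mono (le_inf hP hQ)
  have hlt := finrank_inf_lt hPQ
  rw [MeetInHyperplane]
  omega

theorem adj_of_le (hP : W ≤ P.1) (hQ : W ≤ Q.1) (hW : finrank F W + 1 = m)
    (h : ¬ SameFiber P Q) : Adj P Q :=
  ⟨meetInHyperplane_of_le hP hQ hW fun hPQ => h (hPQ ▸ rfl), h⟩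

theorem MeetInHyperplane.inf_eq_of_le (h : MeetInHyperplane P Q) (hP : W ≤ P.1) (hQ : W ≤ Q.1)
    (hW : finrank F W + 1 = m) : P.1 ⊓ Q.1 = W :=
  (Submodule.eq_of_le_of_finrank_eq (le_inf hP hQ) (Nat.succ_injective (hW.trans (Eq.symm h)))).symm

theorem Adj.inf_sup_eq (h : Adj P Q) : P.1 ⊓ (Q.1 ⊔ E) = P.1 ⊓ Q.1 :=
  (Submodule.eq_of_le_of_finrank_le (inf_le_inf_left _ le_sup_left) <|
    Nat.succ_le_succ_iff.1 <| (finrank_inf_sup_add_one_le h.2).trans h.1.ge).symm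

theorem MeetInHyperplane.color_eq_color (hPQ : MeetInHyperplane P Q) (hRS : MeetInHyperplane R S)
    (h : SameFiber P Q ↔ SameFiber R S) : color E P.1 Q.1 = color E R.1 S.1 := by
  have hinf : finrank F ↥(P.1 ⊓ Q.1) = finrank F ↥(R.1 ⊓ S.1) :=
    Nat.succ_injective (hPQ.trans (Eq.symm hRS))
  refine color_eq_iff.2 ⟨?_, hinf⟩
  by_cases hfib : SameFiber P Q
  · rw [sameFiber_iff_finrank_inf_sup.1 hfib, sameFiber_iff_finrank_inf_sup.1 (h.1 hfib)]
  · rw [Adj.inf_sup_eq ⟨hPQ, hfib⟩, Adj.inf_sup_eq ⟨hRS, mt h.2 hfib⟩, hinf]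

theorem Adj.color_eq_color (hPQ : Adj P Q) (hRS : Adj R S) :
    color E P.1 Q.1 = color E R.1 S.1 :=
  hPQ.1.color_eq_color hRS.1 (iff_of_false hPQ.2 hRS.2)

theorem Adj.of_color_eq (h : Adj P Q) (hc : color E R.1 S.1 = color E P.1 Q.1) : Adj R S :=
  ⟨(congrArg (· + 1) (color_eq_iff.1 hc).2).trans h.1, mt (sameFiber_iff_of_color_eq hc).1 h.2⟩

theorem rel_of_meetInHyperplane_rel {r : Transversal E m → Transversal E m → Prop}
    (hr : Equivalence r) (h : ∀ P Q, MeetInHyperplane P Q → r P Q) (P Q : Transversal E m) :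
    r P Q := by
  induction hk : m - finrank F ↥(P.1 ⊓ Q.1) using Nat.strong_induction_on generalizing P with
  | _ k ih =>
    by_cases hPQ : P = Q
    · exact hPQ ▸ hr.refl P
    obtain ⟨R, hR, hPR, hlt⟩ :=
      exists_meet_in_hyperplane_finrank_inf_lt P.2 Q.2 (fun h => hPQ (Subtype.ext h))
    have hle : finrank F ↥(R ⊓ Q.1) ≤ m := (finrank_mono inf_le_left).trans hR.finrank_eq.le
    exact hr.trans (h P ⟨R, hR⟩ hPR) (ih _ (by dsimp only; omega) ⟨R, hR⟩ rfl)

end Fiber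

section Imprimitivity

variable {F V : Type*} [Field F] [AddCommGroup V] [Module F V] [FiniteDimensional F V]
  {E : Submodule F V} {m : ℕ} {r : Transversal E m → Transversal E m → Prop}
  {P Q : Transversal E m}

theorem exists_hyperplane_forall_exchange_rel (hr : Equivalence r)
    (hc : ∀ P Q R S : Transversal E m, color E P.1 Q.1 = color E R.1 S.1 → r P Q → r R S)
    (hPQ : r P Q) (h : ¬ SameFiber P Q) :
    ∃ H, H ≤ Q.1 ∧ finrank F H + 1 = m ∧ ∃ q ∈ Q.1, ∀ y ∈ P.1 ⊔ E,
      ∃ T : Transversal E m, T.1 = H ⊔ span F {q + y} ∧ r T Q := by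
  obtain ⟨q, hq, hqP⟩ := SetLike.not_le_iff_exists.1 fun hle =>
    h (sameFiber_iff_le.2 hle).symm
  obtain ⟨H, hQPH, hHQ, hqH, hH⟩ := Q.2.exists_hyperplane_notMem (D := Q.1 ⊓ (P.1 ⊔ E))
    inf_le_left hq (fun h => hqP h.2)
  refine ⟨H, hHQ, hH, q, hq, fun y hy => ?_⟩
  have hqy : q + y ∉ H ⊔ (P.1 ⊔ E) := fun hmem => by
    obtain ⟨a, ha, b, hb, hab⟩ := mem_sup.1 ((add_mem_cancel_right (mem_sup_right hy)).1 hmem)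
    have hbQ : b ∈ Q.1 := (add_mem_cancel_left (hHQ ha)).1 (hab ▸ hq)
    exact hqH (hab ▸ add_mem ha (hQPH ⟨hbQ, hb⟩))
  refine ⟨⟨_, Q.2.exchange hHQ hH fun hmem => hqy (sup_le_sup_left le_sup_right H hmem)⟩, rfl, ?_⟩
  refine hr.trans (hc Q P _ P (color_eq_of_inf_sup_eq ?_) (hr.symm hPQ)) hPQ
  rw [sup_span_singleton_inf hqy]
  exact le_antisymm (le_inf hQPH inf_le_right) (inf_le_inf_right _ hHQ)

/-- Moving a vector of `Q` by a vector of `E`, respectively of `P`, yields one related pair for each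
of the two colors of pairs that meet in a hyperplane, and these pairs connect everything. -/
theorem rel_of_color_invariant (hE : E ≠ ⊥) (hr : Equivalence r)
    (hc : ∀ P Q R S : Transversal E m, color E P.1 Q.1 = color E R.1 S.1 → r P Q → r R S)
    (hPQ : r P Q) (h : ¬ SameFiber P Q) (R S : Transversal E m) : r R S := by
  obtain ⟨H, hHQ, hH, q, hq, hexchange⟩ := exists_hyperplane_forall_exchange_rel hr hc hPQ h
  obtain ⟨e, he, he0⟩ := exists_mem_ne_zero_of_ne_bot hE
  obtain ⟨p, hp, hpQ⟩ := SetLike.not_le_iff_exists.1 (mt sameFiber_iff_le.2 h)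
  obtain ⟨T, hT, hTQ⟩ := hexchange e (mem_sup_right he)
  obtain ⟨U, hU, hUQ⟩ := hexchange p (mem_sup_left hp)
  have hqT : q + e ∈ T.1 := hT ▸ mem_sup_right (mem_span_singleton_self _)
  have hqU : q + p ∈ U.1 := hU ▸ mem_sup_right (mem_span_singleton_self _)
  have hT_fiber : SameFiber T Q := sameFiber_iff_le.2 <| hT ▸ sup_le (hHQ.trans le_sup_left)
    (by simpa using add_mem (mem_sup_left hq) (mem_sup_right he))
  have hT_meet : MeetInHyperplane T Q := by
    refine meetInHyperplane_of_le (hT ▸ le_sup_left) hHQ hH ?_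
    rintro rfl
    exact he0 (T.2.eq_zero ((add_mem_cancel_left hq).1 hqT) he)
  have hU_fiber : ¬ SameFiber U Q := fun hfib =>
    hpQ ((add_mem_cancel_left (mem_sup_left hq)).1 (sameFiber_iff_le.1 hfib hqU))
  have hU_adj : Adj U Q := adj_of_le (hU ▸ le_sup_left) hHQ hH hU_fiber
  refine rel_of_meetInHyperplane_rel hr (fun A B hAB => ?_) R S
  by_cases hfib : SameFiber A B
  · exact hc T Q A B (hT_meet.color_eq_color hAB (iff_of_true hT_fiber hfib)) hTQ
  · exact hc U Q A B (hU_adj.color_eq_color ⟨hAB, hfib⟩) hUQ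

end Imprimitivity

section Adjacency

variable {F V : Type*} [Field F] [AddCommGroup V] [Module F V] {E : Submodule F V} {m : ℕ}

/-- `A` lies in the fiber of `P` and is in the same relation with `Q` as `P`. -/
def Twin (P Q A : Transversal E m) : Prop :=
  SameFiber A P ∧ color E A.1 Q.1 = color E P.1 Q.1

/-- The set of twins of `P` with respect to `Q` is minimal among the sets of twins of `P` with
respect to subspaces outside the fiber of `P`. -/
def MinTwin (P Q : Transversal E m) : Prop :=
  ∀ R, ¬ SameFiber P R → (∀ A, Twin P R A → Twin P Q A) → ∀ A, Twin P Q A → Twin P R A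

variable {P Q R A : Transversal E m} {W : Submodule F V}

theorem inf_sup_eq_of_sameFiber_of_le (hR : SameFiber R P) (h : P.1 ⊓ (Q.1 ⊔ E) ≤ R.1) :
    P.1 ⊓ (Q.1 ⊔ E) = R.1 ⊓ (Q.1 ⊔ E) := by
  rw [← sup_inf_eq_of_le_of_disjoint h R.2.disjoint, inf_sup_sup_eq, ← hR, ← inf_sup_sup_eq,
    sup_inf_eq_of_le_of_disjoint inf_le_left R.2.disjoint]

theorem twin_of_inf_sup_le (hA : SameFiber A P) (h : P.1 ⊓ (Q.1 ⊔ E) ≤ A.1) : Twin P Q A :=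
  ⟨hA, (color_eq_of_inf_sup_eq (inf_sup_eq_of_sameFiber_of_le hA h)).symm⟩

variable [FiniteDimensional F V]

theorem Adj.inf_eq_of_sameFiber (hPQ : Adj P Q) (hRQ : Adj R Q) (hRP : SameFiber R P) :
    R.1 ⊓ Q.1 = P.1 ⊓ Q.1 := by
  rw [← sup_inf_eq_of_le_of_disjoint (inf_le_right : R.1 ⊓ Q.1 ≤ Q.1) Q.2.disjoint,
    ← hRQ.inf_sup_eq, inf_sup_sup_eq, hRP, ← inf_sup_sup_eq, hPQ.inf_sup_eq,
    sup_inf_eq_of_le_of_disjoint inf_le_right Q.2.disjoint]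

theorem Adj.twin_iff (h : Adj P Q) : Twin P Q A ↔ SameFiber A P ∧ P.1 ⊓ Q.1 ≤ A.1 := by
  refine ⟨fun hA => ⟨hA.1, ?_⟩, fun hA => twin_of_inf_sup_le hA.1 (h.inf_sup_eq ▸ hA.2)⟩
  exact (h.inf_eq_of_sameFiber (h.of_color_eq hA.2) hA.1).ge.trans inf_le_left

theorem exists_sameFiber_notMem (hE : E ≠ ⊥) {D : Submodule F V} {w : V} (hD : D ≤ P.1)
    (hw : w ∈ P.1) (hwD : w ∉ D) : ∃ R : Transversal E m, SameFiber R P ∧ D ≤ R.1 ∧ w ∉ R.1 := by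
  obtain ⟨e, he, he0⟩ := exists_mem_ne_zero_of_ne_bot hE
  obtain ⟨H, hDH, hHP, hwH, hH⟩ := P.2.exists_hyperplane_notMem hD hw hwD
  have hweP : w + e ∉ P.1 := fun h => he0 (P.2.eq_zero ((add_mem_cancel_left hw).1 h) he)
  have hR := P.2.exchange hHP hH (P.2.add_notMem_sup hHP hw hwH he)
  refine ⟨⟨_, hR⟩, sameFiber_iff_le.2 (sup_le (hHP.trans le_sup_left) ?_),
    hDH.trans le_sup_left, fun hwR => hwH ?_⟩
  · simpa using add_mem (mem_sup_left hw) (mem_sup_right he)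
  · exact (sup_span_singleton_inf_of_le hHP hweP).le ⟨hwR, hw⟩

theorem exists_adj_inf_eq (hn : m + finrank F E < finrank F V) (hWP : W ≤ P.1)
    (hW : finrank F W + 1 = m) : ∃ Q : Transversal E m, Adj P Q ∧ P.1 ⊓ Q.1 = W := by
  obtain ⟨x, -, hx⟩ :=
    SetLike.exists_of_lt (lt_top_of_finrank_lt_finrank (P.2.finrank_sup.trans_lt hn))
  have hQ := P.2.exchange hWP hW fun h => hx (sup_le_sup_right hWP E h)
  have hadj : Adj P ⟨_, hQ⟩ := adj_of_le hWP le_sup_left hW fun h => hx <|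
    sameFiber_iff_le.1 h.symm (mem_sup_right (mem_span_singleton_self x))
  exact ⟨_, hadj, hadj.1.inf_eq_of_le hWP le_sup_left hW⟩

theorem exists_not_sameFiber (hm : 0 < m) (hn : m + finrank F E < finrank F V)
    (P : Transversal E m) : ∃ Q, ¬ SameFiber P Q := by
  have hP : P.1 ≠ ⊥ := one_le_finrank_iff.1 (P.2.finrank_eq.symm ▸ hm)
  obtain ⟨x, hx, hx0⟩ := exists_mem_ne_zero_of_ne_bot hP
  obtain ⟨H, -, hHP, -, hH⟩ := P.2.exists_hyperplane_notMem bot_le hx (by simpa using hx0)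
  obtain ⟨Q, hQ, -⟩ := exists_adj_inf_eq hn hHP hH
  exact ⟨Q, hQ.2⟩

theorem le_inf_sup_of_forall_twin_le (hE : E ≠ ⊥) (hW : W ≤ P.1)
    (h : ∀ A, Twin P R A → W ≤ A.1) : W ≤ P.1 ⊓ (R.1 ⊔ E) := by
  intro w hw
  by_contra hwD
  obtain ⟨A, hAP, hDA, hwA⟩ := exists_sameFiber_notMem hE inf_le_left (hW hw) hwD
  exact hwA (h A (twin_of_inf_sup_le hAP hDA) hw)

theorem Adj.minTwin (hE : E ≠ ⊥) (h : Adj P Q) : MinTwin P Q := by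
  intro R hR hsub A hA
  have hle : P.1 ⊓ Q.1 ≤ P.1 ⊓ (R.1 ⊔ E) :=
    le_inf_sup_of_forall_twin_le hE inf_le_left fun A hA => (h.twin_iff.1 (hsub A hA)).2
  have heq : P.1 ⊓ Q.1 = P.1 ⊓ (R.1 ⊔ E) := Submodule.eq_of_le_of_finrank_le hle <|
    Nat.succ_le_succ_iff.1 <| (finrank_inf_sup_add_one_le hR).trans h.1.ge
  exact twin_of_inf_sup_le hA.1 (heq ▸ (h.twin_iff.1 hA).2)

theorem MinTwin.finrank_and_inf_sup_le (hE : E ≠ ⊥) (hn : m + finrank F E < finrank F V)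
    (h : MinTwin P Q) (hPQ : ¬ SameFiber P Q) :
    finrank F ↥(P.1 ⊓ (Q.1 ⊔ E)) + 1 = m ∧ ∀ A, Twin P Q A → P.1 ⊓ (Q.1 ⊔ E) ≤ A.1 := by
  obtain ⟨x, hx, hxQ⟩ := SetLike.not_le_iff_exists.1 (mt sameFiber_iff_le.2 hPQ)
  obtain ⟨H, hleH, hHP, -, hH⟩ := P.2.exists_hyperplane_notMem (D := P.1 ⊓ (Q.1 ⊔ E)) inf_le_left
    hx (fun h => hxQ h.2)
  obtain ⟨R, hR, hPRH⟩ := exists_adj_inf_eq hn hHP hH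
  have hsub : ∀ A, Twin P R A → Twin P Q A := fun A hA =>
    twin_of_inf_sup_le hA.1 (hleH.trans (hPRH ▸ (hR.twin_iff.1 hA).2))
  have hHA : ∀ A, Twin P Q A → H ≤ A.1 := fun A hA =>
    hPRH ▸ (hR.twin_iff.1 (h R hR.2 hsub A hA)).2
  rw [le_antisymm hleH (le_inf_sup_of_forall_twin_le hE hHP hHA)]
  exact ⟨hH, hHA⟩

theorem Adj.exists_third (h : Adj P Q) : ∃ R, Adj P R ∧ Adj R Q ∧ P.1 ⊓ R.1 = P.1 ⊓ Q.1 := by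
  obtain ⟨p, hp, hpQ⟩ := SetLike.not_le_iff_exists.1 (mt sameFiber_iff_le.2 h.2)
  obtain ⟨q, hq, hqP⟩ := SetLike.not_le_iff_exists.1 (mt sameFiber_iff_le.2 h.symm.2)
  have hP : p + q ∉ P.1 ⊔ E := fun h => hqP ((add_mem_cancel_left (mem_sup_left hp)).1 h)
  have hQ : p + q ∉ Q.1 ⊔ E := fun h => hpQ ((add_mem_cancel_right (mem_sup_left hq)).1 h)
  have hR := P.2.exchange inf_le_left h.1 fun h => hP (sup_le_sup_right inf_le_left E h)
  have hmem : p + q ∈ P.1 ⊓ Q.1 ⊔ span F {p + q} := mem_sup_right (mem_span_singleton_self _)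
  have hPR : Adj P ⟨_, hR⟩ := adj_of_le inf_le_left le_sup_left h.1 fun hfib =>
    hP (sameFiber_iff_le.1 hfib.symm hmem)
  have hRQ : Adj ⟨_, hR⟩ Q := adj_of_le le_sup_left inf_le_right h.1 fun hfib =>
    hQ (sameFiber_iff_le.1 hfib hmem)
  exact ⟨_, hPR, hRQ, hPR.1.inf_eq_of_le inf_le_left le_sup_left h.1⟩

theorem exists_sameFiber_inf_sup_eq (hWP : W ≤ P.1) (hW : finrank F W + 1 = m)
    (hWR : W ≤ R.1 ⊔ E) :
    ∃ A : Transversal E m, SameFiber A P ∧ A.1 ⊓ (W ⊔ E) = R.1 ⊓ (W ⊔ E) := by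
  have hsup : R.1 ⊓ (W ⊔ E) ⊔ E = W ⊔ E := by
    rw [inf_sup_sup_eq, inf_eq_right.2 (sup_le hWR le_sup_right)]
  have hfinrank : finrank F ↥(R.1 ⊓ (W ⊔ E)) + 1 = m := by
    have hR := (R.2.mono (inf_le_left : R.1 ⊓ (W ⊔ E) ≤ R.1)).finrank_sup
    rw [hsup, (P.2.mono hWP).finrank_sup] at hR
    omega
  obtain ⟨x, hx, hxW⟩ : ∃ x ∈ P.1, x ∉ W :=
    exists_mem_notMem_of_finrank_lt (by rw [P.2.finrank_eq]; omega)
  have hxWE : x ∉ W ⊔ E := fun h =>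
    hxW (sup_inf_eq_of_le_of_disjoint hWP P.2.disjoint ▸ ⟨h, hx⟩)
  have hA := R.2.exchange inf_le_left hfinrank (hsup ▸ hxWE)
  exact ⟨⟨_, hA⟩, sameFiber_iff_le.2 (sup_le (inf_le_right.trans (sup_le_sup_right hWP E))
    (by simpa using mem_sup_left hx)), sup_span_singleton_inf_of_le inf_le_right hxWE⟩

theorem MinTwin.adj (hE : E ≠ ⊥) (hn : m + finrank F E < finrank F V) (h : MinTwin P Q)
    (hPQ : ¬ SameFiber P Q) (hPR : color E P.1 R.1 = color E P.1 Q.1)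
    (hRQ : color E R.1 Q.1 = color E P.1 Q.1) (htwin : ∀ A, Twin P R A ↔ Twin P Q A) :
    Adj P Q := by
  obtain ⟨hW, hW_le⟩ := h.finrank_and_inf_sup_le hE hn hPQ
  set W := P.1 ⊓ (Q.1 ⊔ E)
  have hWP : W ≤ P.1 := inf_le_left
  have hWR : W ≤ R.1 ⊔ E :=
    (le_inf_sup_of_forall_twin_le hE hWP fun A hA => hW_le A ((htwin A).1 hA)).trans inf_le_right
  have hPQ_sup : (P.1 ⊔ E) ⊓ (Q.1 ⊔ E) = W ⊔ E := (inf_sup_sup_eq _ _ _).symm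
  have hRQ_sup : (R.1 ⊔ E) ⊓ (Q.1 ⊔ E) = W ⊔ E := by
    refine (Submodule.eq_of_le_of_finrank_eq (le_inf (sup_le hWR le_sup_right)
      (sup_le inf_le_right le_sup_right)) ?_).symm
    rw [finrank_sup_inf_sup R.2.disjoint, (color_eq_iff.1 hRQ).1, ← hPQ_sup,
      finrank_sup_inf_sup P.2.disjoint]
  obtain ⟨A, hAP, hAR⟩ := exists_sameFiber_inf_sup_eq hWP hW hWR
  have hA : Twin P Q A := by
    have inf_eq {B : Transversal E m} (hB : (B.1 ⊔ E) ⊓ (Q.1 ⊔ E) = W ⊔ E) :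
        B.1 ⊓ (Q.1 ⊔ E) = B.1 ⊓ (W ⊔ E) := by
      rw [← hB, ← inf_assoc, inf_sup_self]
    refine ⟨hAP, (color_eq_of_inf_sup_eq ?_).trans hRQ⟩
    rw [inf_eq hRQ_sup, inf_eq (by rw [hAP, hPQ_sup]), hAR]
  have hWR' : W ≤ R.1 := (le_inf (hW_le A hA) le_sup_left).trans (hAR.le.trans inf_le_left)
  have hPR_fiber : ¬ SameFiber P R := mt (sameFiber_iff_of_color_eq hPR).1 hPQ
  exact (adj_of_le hWP hWR' hW hPR_fiber).of_color_eq hPR.symm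

/-- Minimality of the twins alone gives `dim (P' ∩ Q') = m - 1` and that all twins contain
`P ∩ (Q + E)`; the third subspace `R` forces `P` and `Q` to meet there. -/
theorem adj_iff_minTwin (hE : E ≠ ⊥) (hn : m + finrank F E < finrank F V) :
    Adj P Q ↔ ¬ SameFiber P Q ∧ MinTwin P Q ∧ ∃ R, color E P.1 R.1 = color E P.1 Q.1 ∧
      color E R.1 Q.1 = color E P.1 Q.1 ∧ ∀ A, Twin P R A ↔ Twin P Q A := by
  constructor
  · intro h
    obtain ⟨R, hPR, hRQ, hinf⟩ := h.exists_third
    refine ⟨h.2, h.minTwin hE, R, hPR.color_eq_color h, hRQ.color_eq_color h, fun A => ?_⟩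
    rw [h.twin_iff, hPR.twin_iff, hinf]
  · rintro ⟨hfib, hmin, R, hPR, hRQ, htwin⟩
    exact hmin.adj hE hn hfib hPR hRQ htwin

variable {σ : Equiv.Perm (Transversal E m)}

theorem PermutesColors.sameFiber_of_apply (hσ : PermutesColors σ) (hE : E ≠ ⊥) (hm : 0 < m)
    (hn : m + finrank F E < finrank F V) (h : SameFiber (σ P) (σ Q)) : SameFiber P Q := by
  by_contra hPQ
  obtain ⟨S, hS⟩ := exists_not_sameFiber hm hn P
  have hall : SameFiber (σ (σ.symm P)) (σ (σ.symm S)) :=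
    rel_of_color_invariant hE (sameFiber_equivalence.comap σ)
      (fun P Q R S hc => (sameFiber_iff_of_color_eq ((hσ P Q R S).1 hc)).1) h hPQ _ _
  exact hS (by simpa using hall)

theorem PermutesColors.sameFiber_apply_iff (hσ : PermutesColors σ) (hE : E ≠ ⊥) (hm : 0 < m)
    (hn : m + finrank F E < finrank F V) : SameFiber (σ P) (σ Q) ↔ SameFiber P Q :=
  ⟨hσ.sameFiber_of_apply hE hm hn,
    fun h => hσ.symm.sameFiber_of_apply hE hm hn (by simpa using h)⟩

theorem PermutesColors.adj_apply_iff (hσ : PermutesColors σ) (hE : E ≠ ⊥) (hm : 0 < m)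
    (hn : m + finrank F E < finrank F V) : Adj (σ P) (σ Q) ↔ Adj P Q := by
  have hfib (P Q) : SameFiber P Q ↔ SameFiber (σ P) (σ Q) :=
    (hσ.sameFiber_apply_iff hE hm hn).symm
  have htwin (P Q A) : Twin P Q A ↔ Twin (σ P) (σ Q) (σ A) :=
    and_congr (hfib A P) (hσ A Q P Q)
  have hmin : MinTwin P Q ↔ MinTwin (σ P) (σ Q) :=
    σ.forall_congr fun R => imp_congr (not_congr (hfib P R)) <| imp_congr
      (σ.forall_congr fun A => imp_congr (htwin P R A) (htwin P Q A))
      (σ.forall_congr fun A => imp_congr (htwin P Q A) (htwin P R A))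
  rw [adj_iff_minTwin hE hn, adj_iff_minTwin hE hn, ← hmin, ← hfib]
  refine and_congr_right fun _ => and_congr_right fun _ => (σ.exists_congr fun R => ?_).symm
  exact and_congr (hσ _ _ _ _) <| and_congr (hσ _ _ _ _) <|
    σ.forall_congr fun A => iff_congr (htwin P R A) (htwin P Q A)

end Adjacency

section Descent

variable {F V : Type*} [Field F] [AddCommGroup V] [Module F V] {E : Submodule F V} {m : ℕ}

/-- `σ` preserves and reflects adjacency and fibers. This is what descends from dimension `m + 1`
to dimension `m`. -/
structure PreservesAdj (σ : Equiv.Perm (Transversal E m)) : Prop where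
  sameFiber_iff : ∀ P Q, SameFiber (σ P) (σ Q) ↔ SameFiber P Q
  adj_iff : ∀ P Q, Adj (σ P) (σ Q) ↔ Adj P Q

/-- `τ` is a collineation of the geometry of points outside `E` whose lines are those that do not
meet `E`. -/
structure IsCollineation (τ : Equiv.Perm (Transversal E 1)) : Prop where
  sameFiber_iff : ∀ p q, SameFiber (τ p) (τ q) ↔ SameFiber p q
  le_sup_iff : ∀ p q r, ¬ SameFiber p q → (r.1 ≤ p.1 ⊔ q.1 ↔ (τ r).1 ≤ (τ p).1 ⊔ (τ q).1)

theorem PreservesAdj.symm {σ : Equiv.Perm (Transversal E m)} (hσ : PreservesAdj σ) :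
    PreservesAdj σ.symm where
  sameFiber_iff P Q := by simpa using (hσ.sameFiber_iff (σ.symm P) (σ.symm Q)).symm
  adj_iff P Q := by simpa using (hσ.adj_iff (σ.symm P) (σ.symm Q)).symm

theorem IsCollineation.symm {τ : Equiv.Perm (Transversal E 1)} (hτ : IsCollineation τ) :
    IsCollineation τ.symm where
  sameFiber_iff p q := by simpa using (hτ.sameFiber_iff (τ.symm p) (τ.symm q)).symm
  le_sup_iff p q r hpq := by
    have hpq' : ¬ SameFiber (τ.symm p) (τ.symm q) := by
      rw [← hτ.sameFiber_iff]
      simpa using hpq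
    simpa using (hτ.le_sup_iff (τ.symm p) (τ.symm q) (τ.symm r) hpq').symm

variable [FiniteDimensional F V]

theorem PermutesColors.preservesAdj {σ : Equiv.Perm (Transversal E m)} (hσ : PermutesColors σ)
    (hE : E ≠ ⊥) (hm : 0 < m) (hn : m + finrank F E < finrank F V) : PreservesAdj σ where
  sameFiber_iff _ _ := hσ.sameFiber_apply_iff hE hm hn
  adj_iff _ _ := hσ.adj_apply_iff hE hm hn

/-- The right-hand side involves adjacency and fibers only; this is why a permutation that preserves
both also permutes the subspaces of dimension `m - 1`. -/
theorem Adj.inf_le_iff (hE : E ≠ ⊥) {P Q : Transversal E m} (h : Adj P Q) (R : Transversal E m) :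
    P.1 ⊓ Q.1 ≤ R.1 ↔ (SameFiber R P ∧ Adj R Q) ∨
      (¬ SameFiber R P ∧ ∀ A, SameFiber A P → Adj A Q → Adj R A) := by
  constructor
  · intro hle
    by_cases hRP : SameFiber R P
    · exact .inl ⟨hRP, h.of_color_eq (h.twin_iff.2 ⟨hRP, hle⟩).2⟩
    · refine .inr ⟨hRP, fun A hAP hAQ => adj_of_le hle ?_ h.1 fun hRA => hRP (hRA.trans hAP)⟩
      exact (h.inf_eq_of_sameFiber hAQ hAP).ge.trans inf_le_left
  · rintro (⟨hRP, hRQ⟩ | ⟨-, hadj⟩)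
    · exact (h.inf_eq_of_sameFiber hRQ hRP).ge.trans inf_le_left
    · have hPR := (hadj P rfl h).symm
      have hle : P.1 ⊓ R.1 ≤ P.1 ⊓ Q.1 := by
        intro d hd
        by_contra hdPQ
        obtain ⟨A, hAP, hPQA, hdA⟩ := exists_sameFiber_notMem hE inf_le_left hd.1 hdPQ
        have hAQ := h.of_color_eq (h.twin_iff.2 ⟨hAP, hPQA⟩).2
        exact hdA ((hPR.inf_eq_of_sameFiber (hadj A hAP hAQ).symm hAP).ge hd).1
      rw [← Submodule.eq_of_le_of_finrank_eq hle (Nat.succ_injective (hPR.1.trans (Eq.symm h.1)))]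
      exact inf_le_right

theorem exists_adj_inf_eq_of_transversal (hn : m + 1 + finrank F E < finrank F V)
    (W : Transversal E m) : ∃ P Q : Transversal E (m + 1), Adj P Q ∧ P.1 ⊓ Q.1 = W.1 := by
  obtain ⟨x, -, hx⟩ := SetLike.exists_of_lt <| lt_top_of_finrank_lt_finrank <|
    W.2.finrank_sup.trans_lt (by omega : m + finrank F E < finrank F V)
  exact ⟨⟨_, W.2.sup_span_singleton hx⟩,
    exists_adj_inf_eq hn le_sup_left (by rw [W.2.finrank_eq])⟩

theorem eq_of_forall_le_imp_le (hn : m + 1 + finrank F E < finrank F V) {W U : Transversal E m}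
    (h : ∀ R : Transversal E (m + 1), W.1 ≤ R.1 → U.1 ≤ R.1) : U = W := by
  obtain ⟨P, Q, -, hW⟩ := exists_adj_inf_eq_of_transversal hn W
  refine Subtype.ext (U.2.eq_of_le W.2 (hW ▸ le_inf (h P ?_) (h Q ?_)))
  · exact hW ▸ inf_le_left
  · exact hW ▸ inf_le_right

theorem Adj.isTransversal_sup {W U : Transversal E m} (h : Adj W U) :
    IsTransversal E (m + 1) (W.1 ⊔ U.1) := by
  obtain ⟨x, hxU, hxW⟩ := SetLike.not_le_iff_exists.1 (mt sameFiber_iff_le.2 h.symm.2)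
  have htrans := W.2.sup_span_singleton hxW
  convert htrans using 1
  refine (Submodule.eq_of_le_of_finrank_eq (sup_le_sup_left (by simpa using hxU) _) ?_).symm
  have hmeet : finrank F ↥(W.1 ⊓ U.1) + 1 = m := h.1
  have hsum := finrank_sup_add_finrank_inf_eq W.1 U.1
  rw [W.2.finrank_eq, U.2.finrank_eq] at hsum
  rw [htrans.finrank_eq]
  omega

theorem adj_iff_ne_and_exists_le {W U : Transversal E m} :
    Adj W U ↔ W ≠ U ∧ ∃ P : Transversal E (m + 1), W.1 ≤ P.1 ∧ U.1 ≤ P.1 := by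
  constructor
  · intro h
    exact ⟨fun hWU => h.2 (hWU ▸ rfl), ⟨_, h.isTransversal_sup⟩, le_sup_left, le_sup_right⟩
  · rintro ⟨hne, P, hW, hU⟩
    refine ⟨?_, fun h => hne (Subtype.ext ?_)⟩
    · have hsum := finrank_sup_add_finrank_inf_eq W.1 U.1
      have hsup := finrank_mono (sup_le hW hU)
      have hinf := finrank_inf_lt hne
      rw [W.2.finrank_eq, U.2.finrank_eq] at hsum
      rw [P.2.finrank_eq] at hsup
      rw [MeetInHyperplane]
      omega
    · rw [← sup_inf_eq_of_le_of_disjoint hW P.2.disjoint, h,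
        sup_inf_eq_of_le_of_disjoint hU P.2.disjoint]

theorem SameFiber.exists_sameFiber_of_le {W U : Transversal E m} (h : SameFiber W U)
    {P : Transversal E (m + 1)} (hWP : W.1 ≤ P.1) :
    ∃ Q : Transversal E (m + 1), U.1 ≤ Q.1 ∧ SameFiber P Q := by
  obtain ⟨x, hx, hxW⟩ : ∃ x ∈ P.1, x ∉ W.1 :=
    exists_mem_notMem_of_finrank_lt (by rw [P.2.finrank_eq, W.2.finrank_eq]; omega)
  have hxU : x ∉ U.1 ⊔ E := fun hmem => hxW <| by
    rw [← sup_inf_eq_of_le_of_disjoint hWP P.2.disjoint]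
    exact ⟨h.ge hmem, hx⟩
  refine ⟨⟨_, U.2.sup_span_singleton hxU⟩, le_sup_left,
    (sameFiber_iff_le.2 (sup_le ?_ ?_)).symm⟩
  · exact le_sup_left.trans (h.ge.trans (sup_le_sup_right hWP E))
  · simpa using mem_sup_left hx

theorem sameFiber_iff_forall_le (hn : m + 1 + finrank F E < finrank F V) {W U : Transversal E m} :
    SameFiber W U ↔ ∀ P : Transversal E (m + 1), W.1 ≤ P.1 →
      ∃ Q : Transversal E (m + 1), U.1 ≤ Q.1 ∧ SameFiber P Q := by
  refine ⟨fun h P hWP => h.exists_sameFiber_of_le hWP, fun h => ?_⟩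
  obtain ⟨P, Q, hPQ, hW⟩ := exists_adj_inf_eq_of_transversal hn W
  obtain ⟨A, hUA, hPA⟩ := h P (hW ▸ inf_le_left)
  obtain ⟨B, hUB, hQB⟩ := h Q (hW ▸ inf_le_right)
  refine (sameFiber_iff_le.2 ?_).symm
  rw [← hW, ← hPQ.inf_sup_eq, inf_sup_sup_eq]
  exact le_inf ((hUA.trans le_sup_left).trans hPA.ge) ((hUB.trans le_sup_left).trans hQB.ge)

theorem PreservesAdj.exists_le_iff_le_apply {σ : Equiv.Perm (Transversal E (m + 1))}
    (hσ : PreservesAdj σ) (hE : E ≠ ⊥) (hn : m + 1 + finrank F E < finrank F V)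
    (W : Transversal E m) :
    ∃ U : Transversal E m, ∀ P : Transversal E (m + 1), W.1 ≤ P.1 ↔ U.1 ≤ (σ P).1 := by
  obtain ⟨P, Q, hPQ, hW⟩ := exists_adj_inf_eq_of_transversal hn W
  have hσPQ := (hσ.adj_iff P Q).2 hPQ
  have hU := (σ P).2.mono (inf_le_left : (σ P).1 ⊓ (σ Q).1 ≤ (σ P).1)
  rw [Nat.add_right_cancel hσPQ.1] at hU
  refine ⟨⟨_, hU⟩, fun R => ?_⟩
  rw [← hW, hPQ.inf_le_iff hE, hσPQ.inf_le_iff hE, hσ.sameFiber_iff, hσ.adj_iff]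
  refine or_congr_right (and_congr_right fun _ => σ.forall_congr fun A => ?_)
  rw [hσ.sameFiber_iff, hσ.adj_iff, hσ.adj_iff]

theorem PreservesAdj.exists_perm_le_iff {σ : Equiv.Perm (Transversal E (m + 1))}
    (hσ : PreservesAdj σ) (hE : E ≠ ⊥) (hn : m + 1 + finrank F E < finrank F V) :
    ∃ τ : Equiv.Perm (Transversal E m),
      ∀ (W : Transversal E m) (P : Transversal E (m + 1)), W.1 ≤ P.1 ↔ (τ W).1 ≤ (σ P).1 := by
  choose f hf using hσ.exists_le_iff_le_apply hE hn
  choose g hg using hσ.symm.exists_le_iff_le_apply hE hn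
  exact ⟨{ toFun := f
           invFun := g
           left_inv := fun W => eq_of_forall_le_imp_le hn fun P hP => by
             simpa using (hg (f W) (σ P)).1 ((hf W P).1 hP)
           right_inv := fun W => eq_of_forall_le_imp_le hn fun P hP => by
             simpa using (hf (g W) (σ.symm P)).1 ((hg W P).1 hP) }, hf⟩

theorem PreservesAdj.descend {σ : Equiv.Perm (Transversal E (m + 1))} (hσ : PreservesAdj σ)
    (hn : m + 1 + finrank F E < finrank F V) {τ : Equiv.Perm (Transversal E m)}
    (hτ : ∀ (W : Transversal E m) (P : Transversal E (m + 1)), W.1 ≤ P.1 ↔ (τ W).1 ≤ (σ P).1) :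
    PreservesAdj τ where
  sameFiber_iff W U := by
    rw [sameFiber_iff_forall_le hn, sameFiber_iff_forall_le hn]
    refine (σ.forall_congr fun P => imp_congr (hτ W P) (σ.exists_congr fun Q => ?_)).symm
    rw [hτ, hσ.sameFiber_iff]
  adj_iff W U := by
    rw [adj_iff_ne_and_exists_le, adj_iff_ne_and_exists_le]
    exact (and_congr τ.injective.ne_iff.symm
      (σ.exists_congr fun P => and_congr (hτ W P) (hτ U P))).symm

theorem le_iff_exists_le_le {k : ℕ} (hk : k ≤ m) (p : Transversal E k)
    (P : Transversal E (m + 1)) : p.1 ≤ P.1 ↔ ∃ W : Transversal E m, p.1 ≤ W.1 ∧ W.1 ≤ P.1 := by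
  refine ⟨fun h => ?_, fun ⟨W, hpW, hWP⟩ => hpW.trans hWP⟩
  obtain ⟨x, hx, hxp⟩ : ∃ x ∈ P.1, x ∉ p.1 :=
    exists_mem_notMem_of_finrank_lt (by rw [P.2.finrank_eq, p.2.finrank_eq]; omega)
  obtain ⟨H, hpH, hHP, -, hH⟩ := P.2.exists_hyperplane_notMem h hx hxp
  exact ⟨⟨H, Nat.add_right_cancel hH ▸ P.2.mono hHP⟩, hpH, hHP⟩

theorem adj_of_not_sameFiber {p q : Transversal E 1} (h : ¬ SameFiber p q) : Adj p q :=
  adj_of_le bot_le bot_le (by simp) h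

theorem PreservesAdj.isCollineation {σ : Equiv.Perm (Transversal E 2)}
    {τ : Equiv.Perm (Transversal E 1)} (hτ : PreservesAdj τ)
    (hτσ : ∀ (p : Transversal E 1) (P : Transversal E 2), p.1 ≤ P.1 ↔ (τ p).1 ≤ (σ P).1) :
    IsCollineation τ where
  sameFiber_iff := hτ.sameFiber_iff
  le_sup_iff p q r hpq := by
    have hadj := adj_of_not_sameFiber hpq
    have hσ : (τ p).1 ⊔ (τ q).1 = (σ ⟨_, hadj.isTransversal_sup⟩).1 :=
      ((hτ.adj_iff p q).2 hadj).isTransversal_sup.eq_of_le (σ ⟨_, hadj.isTransversal_sup⟩).2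
        (sup_le ((hτσ _ _).1 le_sup_left) ((hτσ _ _).1 le_sup_right))
    rw [hσ, ← hτσ]

theorem PreservesAdj.exists_collineation {k : ℕ} {σ : Equiv.Perm (Transversal E (k + 2))}
    (hσ : PreservesAdj σ) (hE : E ≠ ⊥) (hn : k + 2 + finrank F E < finrank F V) :
    ∃ τ : Equiv.Perm (Transversal E 1), IsCollineation τ ∧
      ∀ (p : Transversal E 1) (P : Transversal E (k + 2)), p.1 ≤ P.1 ↔ (τ p).1 ≤ (σ P).1 := by
  induction k with
  | zero =>
    obtain ⟨τ, hτσ⟩ := hσ.exists_perm_le_iff hE hn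
    exact ⟨τ, (hσ.descend hn hτσ).isCollineation hτσ, hτσ⟩
  | succ k ih =>
    obtain ⟨ρ, hρσ⟩ := hσ.exists_perm_le_iff hE hn
    obtain ⟨τ, hτ, hτρ⟩ := ih (hσ.descend hn hρσ) (by omega)
    refine ⟨τ, hτ, fun p P => ?_⟩
    rw [le_iff_exists_le_le (by omega), le_iff_exists_le_le (by omega)]
    exact ρ.exists_congr fun W => and_congr (hτρ p W) (hρσ W P)

end Descent

section IndepMod

variable {F V : Type*} [Field F] [AddCommGroup V] [Module F V] {E : Submodule F V} {u v w : V}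

variable (E) in
/-- The vectors `v i` are linearly independent modulo `E`. -/
def IndepMod {k : ℕ} (v : Fin k → V) : Prop := LinearIndependent F fun i => E.mkQ (v i)

theorem indepMod_iff {k : ℕ} {v : Fin k → V} :
    IndepMod E v ↔ ∀ c : Fin k → F, ∑ i, c i • v i ∈ E → ∀ i, c i = 0 := by
  have hmem (c : Fin k → F) : ∑ i, c i • E.mkQ (v i) = 0 ↔ ∑ i, c i • v i ∈ E := by
    rw [← Submodule.Quotient.mk_eq_zero E, ← mkQ_apply]
    simp only [map_sum, map_smul]
  simp only [IndepMod, Fintype.linearIndependent_iff, hmem]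

theorem indepMod_pair_iff :
    IndepMod E ![v, w] ↔ ∀ a b : F, a • v + b • w ∈ E → a = 0 ∧ b = 0 := by
  simp [indepMod_iff, Fin.forall_fin_succ_pi, Fin.sum_univ_succ, Fin.forall_fin_succ]

theorem indepMod_triple_iff :
    IndepMod E ![u, v, w] ↔
      ∀ a b c : F, a • u + b • v + c • w ∈ E → a = 0 ∧ b = 0 ∧ c = 0 := by
  simp [indepMod_iff, Fin.forall_fin_succ_pi, Fin.forall_fin_zero_pi, Fin.sum_univ_succ,
    Fin.forall_fin_succ, add_assoc]

theorem mem_of_add_smul_mem {c : F} (hc : c ≠ 0) (hv : v ∈ E) (h : v + c • w ∈ E) : w ∈ E :=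
  (smul_mem_iff E hc).1 ((add_mem_cancel_left hv).1 h)

theorem indepMod_pair_of_notMem (hv : v ∉ E) (hw : w ∉ E ⊔ span F {v}) : IndepMod E ![v, w] := by
  refine indepMod_pair_iff.2 fun a b h => ?_
  have hb : b = 0 := by_contra fun hb => hw <| mem_of_add_smul_mem hb
    (mem_sup_right (smul_mem _ a (mem_span_singleton_self v))) (mem_sup_left h)
  refine ⟨by_contra fun ha => hv ?_, hb⟩
  rwa [hb, zero_smul, add_zero, smul_mem_iff _ ha] at h

theorem IndepMod.of_sup_span_singleton (hu : u ∉ E) (h : IndepMod (E ⊔ span F {u}) ![v, w]) :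
    IndepMod E ![u, v, w] := by
  refine indepMod_triple_iff.2 fun a b c habc => ?_
  obtain ⟨rfl, rfl⟩ := indepMod_pair_iff.1 h b c <| by
    rw [add_assoc] at habc
    exact (add_mem_cancel_left (mem_sup_right (smul_mem _ a (mem_span_singleton_self u)))).1
      (mem_sup_left habc)
  refine ⟨by_contra fun ha => hu ?_, rfl, rfl⟩
  rwa [zero_smul, zero_smul, add_zero, add_zero, smul_mem_iff _ ha] at habc

theorem indepMod_triple_of_notMem (hu : u ∉ E) (hv : v ∉ E ⊔ span F {u})
    (hw : w ∉ E ⊔ span F {u} ⊔ span F {v}) : IndepMod E ![u, v, w] :=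
  (indepMod_pair_of_notMem hv hw).of_sup_span_singleton hu

theorem IndepMod.symm (h : IndepMod E ![v, w]) : IndepMod E ![w, v] :=
  indepMod_pair_iff.2 fun a b hab => (indepMod_pair_iff.1 h b a (by rwa [add_comm])).symm

theorem IndepMod.add_right (h : IndepMod E ![v, w]) : IndepMod E ![v, v + w] := by
  refine indepMod_pair_iff.2 fun a b hab => ?_
  have := indepMod_pair_iff.1 h (a + b) b (by convert hab using 1; module)
  grind

theorem IndepMod.pair (h : IndepMod E ![u, v, w]) : IndepMod E ![u, v] :=
  indepMod_pair_iff.2 fun a b hab => by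
    simpa using indepMod_triple_iff.1 h a b 0 (by simpa using hab)

theorem IndepMod.smul_add_smul (h : IndepMod E ![u, v, w]) {a b : F} (hE : a • u + b • v ∉ E) :
    IndepMod E ![a • u + b • v, w] := by
  refine indepMod_pair_iff.2 fun c d hcd => ?_
  have hd : d = 0 := (indepMod_triple_iff.1 h (c * a) (c * b) d (by
    convert hcd using 1; module)).2.2
  refine ⟨by_contra fun hc => hE ?_, hd⟩
  rwa [hd, zero_smul, add_zero, smul_mem_iff _ hc] at hcd

theorem IndepMod.add_middle (h : IndepMod E ![u, v, w]) : IndepMod E ![u, u + v, w] := by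
  refine indepMod_triple_iff.2 fun a b c habc => ?_
  have := indepMod_triple_iff.1 h (a + b) b c (by convert habc using 1; module)
  grind

theorem IndepMod.rotate (h : IndepMod E ![u, v, w]) : IndepMod E ![v, w, u] :=
  indepMod_triple_iff.2 fun a b c habc => by
    have := indepMod_triple_iff.1 h c a b (by convert habc using 1; module)
    grind

theorem IndepMod.linearIndependent_pair (h : IndepMod E ![v, w]) : LinearIndependent F ![v, w] :=
  LinearIndependent.pair_iff.2 fun a b hab => indepMod_pair_iff.1 h a b (hab ▸ E.zero_mem)

theorem IndepMod.notMem_left (h : IndepMod E ![v, w]) : v ∉ E := fun hv => by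
  simpa using (indepMod_pair_iff.1 h 1 0 (by simpa using hv)).1

theorem IndepMod.notMem_right (h : IndepMod E ![v, w]) : w ∉ E := h.symm.notMem_left

theorem exists_notMem_sup_span_singleton [FiniteDimensional F V]
    (h : finrank F E + 1 < finrank F V) (x : V) : ∃ z, z ∉ E ⊔ span F {x} := by
  obtain ⟨z, -, hz⟩ : ∃ z ∈ (⊤ : Submodule F V), z ∉ E ⊔ span F {x} := by
    refine exists_mem_notMem_of_finrank_lt ?_
    have hsup := finrank_add_le_finrank_add_finrank E (span F {x})
    have hx : finrank F (span F {x}) ≤ 1 := by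
      simpa using finrank_span_le_card (R := F) ({x} : Set V)
    rw [finrank_top]
    omega
  exact ⟨z, hz⟩

end IndepMod

section AdditiveExtension

variable {F V V' : Type*} [Field F] [AddCommGroup V] [Module F V] [AddCommGroup V']
  {W : Submodule F V} {g : V → V'} {x y z : V}

theorem apply_add_sub_apply_eq_of_indepMod (hg : ∀ x y, IndepMod W ![x, y] → g (x + y) = g x + g y)
    (hx : x ∈ W) (hyz : IndepMod W ![y, z]) : g (x + y) - g y = g (x + z) - g z := by
  have indepMod_add {y z : V} (h : IndepMod W ![y, z]) : IndepMod W ![x + y, z] := by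
    refine indepMod_pair_iff.2 fun a b hab => indepMod_pair_iff.1 h a b ?_
    rwa [smul_add, add_assoc, add_mem_cancel_left (smul_mem _ _ hx)] at hab
  have h₁ := hg _ _ (indepMod_add hyz)
  have h₂ := hg _ _ (indepMod_add hyz.symm)
  rw [add_right_comm, h₁] at h₂
  rw [sub_eq_sub_iff_add_eq_add, h₂]

theorem apply_add_sub_apply_eq (hW : ∀ x, ∃ z, z ∉ W ⊔ span F {x})
    (hg : ∀ x y, IndepMod W ![x, y] → g (x + y) = g x + g y)
    (hy : y ∉ W ⊔ span F {x}) (hz : z ∉ W ⊔ span F {x}) :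
    g (x + y) - g y = g (x + z) - g z := by
  by_cases hx : x ∈ W
  · have hyW : y ∉ W := fun h => hy (mem_sup_left h)
    have hzW : z ∉ W := fun h => hz (mem_sup_left h)
    by_cases hyz : z ∈ W ⊔ span F {y}
    · obtain ⟨t, ht⟩ := hW y
      have hzt : t ∉ W ⊔ span F {z} := fun h =>
        ht (sup_le le_sup_left ((span_singleton_le_iff_mem _ _).2 hyz) h)
      rw [apply_add_sub_apply_eq_of_indepMod hg hx (indepMod_pair_of_notMem hyW ht),
        apply_add_sub_apply_eq_of_indepMod hg hx (indepMod_pair_of_notMem hzW hzt)]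
    · exact apply_add_sub_apply_eq_of_indepMod hg hx (indepMod_pair_of_notMem hyW hyz)
  · rw [hg _ _ (indepMod_pair_of_notMem hx hy), hg _ _ (indepMod_pair_of_notMem hx hz),
      add_sub_cancel_right, add_sub_cancel_right]

theorem map_add_of_eq_apply_add_sub_apply (hW : ∀ x, ∃ z, z ∉ W ⊔ span F {x}) {G : V → V'}
    (hG : ∀ x, ∀ z ∉ W ⊔ span F {x}, G x = g (x + z) - g z) (hx : x ∈ W ⊔ span F {y}) :
    G (x + y) = G x + G y := by
  obtain ⟨z, hz⟩ := hW y
  have hle {t : V} (ht : t ∈ W ⊔ span F {y}) : W ⊔ span F {t} ≤ W ⊔ span F {y} :=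
    sup_le le_sup_left ((span_singleton_le_iff_mem _ _).2 ht)
  have hy : y ∈ W ⊔ span F {y} := mem_sup_right (mem_span_singleton_self y)
  have hyz : y + z ∉ W ⊔ span F {x} := fun h => hz ((add_mem_cancel_left hy).1 (hle hx h))
  rw [hG _ _ fun h => hz (hle (add_mem hx hy) h), hG x _ hyz, hG y _ hz, ← add_assoc,
    sub_add_sub_cancel]

/-- The extension is `x ↦ g (x + z) - g z`, for any `z` independent of `x` modulo `W`. -/
theorem exists_addMonoidHom_eq_of_notMem (hW : ∀ x, ∃ z, z ∉ W ⊔ span F {x})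
    (hg : ∀ x y, IndepMod W ![x, y] → g (x + y) = g x + g y) :
    ∃ G : V →+ V', ∀ x ∉ W, G x = g x := by
  choose Z hZ using hW
  have hG (x z : V) (hz : z ∉ W ⊔ span F {x}) : g (x + Z x) - g (Z x) = g (x + z) - g z :=
    apply_add_sub_apply_eq (fun x => ⟨_, hZ x⟩) hg (hZ x) hz
  have hGg (x : V) (hx : x ∉ W) : g (x + Z x) - g (Z x) = g x := by
    rw [hg _ _ (indepMod_pair_of_notMem hx (hZ x)), add_sub_cancel_right]
  refine ⟨AddMonoidHom.mk' (fun x => g (x + Z x) - g (Z x)) fun x y => ?_, hGg⟩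
  by_cases hx : x ∈ W ⊔ span F {y}
  · exact map_add_of_eq_apply_add_sub_apply (fun x => ⟨_, hZ x⟩) hG hx
  by_cases hy : y ∈ W ⊔ span F {x}
  · rw [add_comm x y, add_comm (_ - _)]
    exact map_add_of_eq_apply_add_sub_apply (fun x => ⟨_, hZ x⟩) hG hy
  have hxy : IndepMod W ![x, y] := indepMod_pair_of_notMem (fun h => hx (mem_sup_left h)) hy
  rw [hGg x hxy.notMem_left, hGg y hxy.notMem_right, hGg _ hxy.add_right.notMem_right, hg x y hxy]

end AdditiveExtension

section Proportional

variable {F V V' : Type*} [Field F] [AddCommGroup V] [Module F V] [AddCommGroup V'] [Module F V']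
  {E : Submodule F V} {f G : V →+ V'}

theorem eq_smul_of_indepMod (hf : ∀ x ∉ E, ∃ s : F, f x = s • G x)
    (hG : ∀ x y, IndepMod E ![x, y] → LinearIndependent F ![G x, G y]) {x y : V}
    (hxy : IndepMod E ![x, y]) {s : F} (hx : f x = s • G x) : f y = s • G y := by
  obtain ⟨t, ht⟩ := hf y hxy.notMem_right
  obtain ⟨r, hr⟩ := hf (x + y) hxy.add_right.notMem_right
  rw [map_add, map_add, hx, ht, smul_add] at hr
  obtain ⟨hsr, htr⟩ := (hG x y hxy).eq_of_pair hr
  rw [ht, htr, hsr]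

theorem exists_forall_eq_smul (hE : ∀ x, ∃ z, z ∉ E ⊔ span F {x})
    (hf : ∀ x ∉ E, ∃ s : F, f x = s • G x)
    (hG : ∀ x y, IndepMod E ![x, y] → LinearIndependent F ![G x, G y]) :
    ∃ s : F, ∀ x, f x = s • G x := by
  obtain ⟨v, hv⟩ : ∃ v, v ∉ E := (hE 0).imp fun v hv h => hv (mem_sup_left h)
  obtain ⟨s, hs⟩ := hf v hv
  have eq_smul_of_notMem (x : V) (hx : x ∉ E) : f x = s • G x := by
    by_cases hxv : x ∈ E ⊔ span F {v}
    · obtain ⟨z, hz⟩ := hE v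
      have hzx : z ∉ E ⊔ span F {x} := fun h =>
        hz (sup_le le_sup_left ((span_singleton_le_iff_mem _ _).2 hxv) h)
      exact eq_smul_of_indepMod hf hG (indepMod_pair_of_notMem hx hzx).symm
        (eq_smul_of_indepMod hf hG (indepMod_pair_of_notMem hv hz) hs)
    · exact eq_smul_of_indepMod hf hG (indepMod_pair_of_notMem hv hxv) hs
  refine ⟨s, fun x => ?_⟩
  by_cases hx : x ∈ E
  · have hvx := eq_smul_of_notMem (v + x) fun h => hv ((add_mem_cancel_right hx).1 h)
    rwa [map_add, map_add, smul_add, hs, add_right_inj] at hvx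
  · exact eq_smul_of_notMem x hx

theorem exists_ringHom_map_smul (h : ∀ c : F, ∃ s : F, ∀ x, G (c • x) = s • G x) {v : V}
    (hv : G v ≠ 0) : ∃ φ : F →+* F, ∀ c x, G (c • x) = φ c • G x := by
  choose φ hφ using h
  have eq_of_smul {s t : F} (hst : s • G v = t • G v) : s = t := smul_left_injective F hv hst
  exact ⟨{ toFun := φ
           map_one' := eq_of_smul (by rw [← hφ, one_smul, one_smul])
           map_mul' := fun a b => eq_of_smul (by rw [← hφ, mul_smul, hφ, hφ, mul_smul])
           map_zero' := eq_of_smul (by rw [← hφ, zero_smul, map_zero, zero_smul])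
           map_add' := fun a b => eq_of_smul (by rw [← hφ, add_smul, map_add, hφ, hφ, add_smul]) },
    hφ⟩

end Proportional

section Lifts

variable {F V : Type*} [Field F] [AddCommGroup V] [Module F V] {E : Submodule F V} {u v w x y z : V}

theorem isTransversal_span_singleton_iff : IsTransversal E 1 (span F {v}) ↔ v ∉ E := by
  refine ⟨fun h hv => ?_, fun hv => ⟨?_, (disjoint_span_singleton_of_notMem hv).symm⟩⟩
  · obtain rfl : v = 0 := h.eq_zero (mem_span_singleton_self v) hv
    have h01 := h.finrank_eq
    rw [span_zero_singleton, finrank_bot] at h01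
    exact zero_ne_one h01
  · exact finrank_span_singleton fun hv0 => hv (hv0 ▸ E.zero_mem)

theorem exists_eq_span_singleton (p : Transversal E 1) : ∃ y, p.1 = span F {y} := by
  obtain ⟨y, -, hy⟩ := finrank_eq_one_iff'.1 p.2.finrank_eq
  refine ⟨y, le_antisymm (fun z hz => ?_) ((span_singleton_le_iff_mem _ _).2 y.2)⟩
  obtain ⟨c, hc⟩ := hy ⟨z, hz⟩
  exact mem_span_singleton.2 ⟨c, congrArg Subtype.val hc⟩

/-- The vector `y` spans the image under `τ` of the line spanned by `v`. -/
def Lifts (τ : Equiv.Perm (Transversal E 1)) (v y : V) : Prop :=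
  ∃ p : Transversal E 1, p.1 = span F {v} ∧ (τ p).1 = span F {y}

variable {τ : Equiv.Perm (Transversal E 1)}

theorem exists_lifts (τ : Equiv.Perm (Transversal E 1)) (hv : v ∉ E) : ∃ y, Lifts τ v y :=
  (exists_eq_span_singleton _).imp fun _ hy =>
    ⟨⟨_, isTransversal_span_singleton_iff.2 hv⟩, rfl, hy⟩

namespace Lifts

theorem symm (h : Lifts τ v y) : Lifts τ.symm y v := by
  obtain ⟨p, hp, hτp⟩ := h
  exact ⟨τ p, hτp, by rwa [τ.symm_apply_apply]⟩

theorem notMem_left (h : Lifts τ v y) : v ∉ E := by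
  obtain ⟨p, hp, -⟩ := h
  exact isTransversal_span_singleton_iff.1 (hp ▸ p.2)

theorem notMem_right (h : Lifts τ v y) : y ∉ E := h.symm.notMem_left

theorem smul_right (h : Lifts τ v y) {c : F} (hc : c ≠ 0) : Lifts τ v (c • y) := by
  obtain ⟨p, hp, hτp⟩ := h
  exact ⟨p, hp, by rw [hτp, span_singleton_smul_eq hc.isUnit]⟩

theorem neg (h : Lifts τ v y) : Lifts τ (-v) (-y) := by
  obtain ⟨p, hp, hτp⟩ := h
  exact ⟨p, by rw [hp, ← Set.neg_singleton, span_neg], by rw [hτp, ← Set.neg_singleton, span_neg]⟩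

theorem eq_smul (h : Lifts τ v y) (h' : Lifts τ v z) : ∃ c : F, c ≠ 0 ∧ z = c • y := by
  obtain ⟨p, hp, hτp⟩ := h
  obtain ⟨q, hq, hτq⟩ := h'
  obtain rfl : p = q := Subtype.ext (hp.trans hq.symm)
  obtain ⟨c, hc⟩ := span_singleton_eq_span_singleton.1 (hτp.symm.trans hτq)
  exact ⟨c, c.ne_zero, hc.symm⟩

end Lifts

variable [FiniteDimensional F V]

theorem not_sameFiber_iff_indepMod {p q : Transversal E 1} (hp : p.1 = span F {v})
    (hq : q.1 = span F {w}) : ¬ SameFiber p q ↔ IndepMod E ![v, w] := by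
  have hv : v ∉ E := isTransversal_span_singleton_iff.1 (hp ▸ p.2)
  have hw : w ∉ E := isTransversal_span_singleton_iff.1 (hq ▸ q.2)
  have hmem : SameFiber p q ↔ v ∈ E ⊔ span F {w} := by
    rw [sameFiber_iff_le, hp, hq, span_singleton_le_iff_mem, sup_comm]
  rw [hmem]
  refine ⟨fun h => (indepMod_pair_of_notMem hw h).symm, fun h hvw => ?_⟩
  obtain ⟨e, he, t, ht, rfl⟩ := mem_sup.1 hvw
  obtain ⟨c, rfl⟩ := mem_span_singleton.1 ht
  exact one_ne_zero (indepMod_pair_iff.1 h 1 (-c) (by simpa using he)).1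

namespace IsCollineation

theorem indepMod_pair (hτ : IsCollineation τ) (hv : Lifts τ v y) (hw : Lifts τ w z)
    (h : IndepMod E ![v, w]) : IndepMod E ![y, z] := by
  obtain ⟨p, hp, hτp⟩ := hv
  obtain ⟨q, hq, hτq⟩ := hw
  rwa [← not_sameFiber_iff_indepMod hτp hτq, hτ.sameFiber_iff, not_sameFiber_iff_indepMod hp hq]

theorem mem_span_pair (hτ : IsCollineation τ) (hv : Lifts τ v y) (hw : Lifts τ w z)
    (hvw : IndepMod E ![v, w]) (hu : Lifts τ u x) (h : u ∈ span F {v, w}) :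
    x ∈ span F {y, z} := by
  obtain ⟨p, hp, hτp⟩ := hv
  obtain ⟨q, hq, hτq⟩ := hw
  obtain ⟨r, hr, hτr⟩ := hu
  have hle := hτ.le_sup_iff p q r ((not_sameFiber_iff_indepMod hp hq).2 hvw)
  rw [hp, hq, hr, hτp, hτq, hτr, ← span_insert, ← span_insert, span_singleton_le_iff_mem,
    span_singleton_le_iff_mem] at hle
  exact hle.1 h

theorem exists_smul_add_smul_eq (hτ : IsCollineation τ) (hv : Lifts τ v y) (hw : Lifts τ w z)
    (hvw : IndepMod E ![v, w]) (hu : Lifts τ (v + w) x) : ∃ a b : F, a • y + b • z = x :=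
  Submodule.mem_span_pair.1 <| hτ.mem_span_pair hv hw hvw hu <|
    Submodule.mem_span_pair.2 ⟨1, 1, by simp⟩

theorem indepMod_triple (hτ : IsCollineation τ) (hu : Lifts τ u x) (hv : Lifts τ v y)
    (hw : Lifts τ w z) (h : IndepMod E ![u, v, w]) : IndepMod E ![x, y, z] := by
  have hxy := hτ.indepMod_pair hu hv h.pair
  refine indepMod_triple_iff.2 fun a b c habc => ?_
  have hc : c = 0 := by_contra fun hc => by
    have hr : a • x + b • y ∉ E := fun hr => hw.notMem_right (mem_of_add_smul_mem hc hr habc)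
    obtain ⟨t, ht⟩ := exists_lifts τ.symm hr
    obtain ⟨a', b', rfl⟩ := Submodule.mem_span_pair.1 <| hτ.symm.mem_span_pair hu.symm hv.symm hxy
      ht (Submodule.mem_span_pair.2 ⟨a, b, rfl⟩)
    have htw : IndepMod E ![a' • u + b' • v, w] := h.smul_add_smul ht.notMem_right
    exact hc (indepMod_pair_iff.1 (hτ.indepMod_pair ht.symm hw htw) 1 c (by rwa [one_smul])).2
  rw [hc, zero_smul, add_zero] at habc
  obtain ⟨ha, hb⟩ := indepMod_pair_iff.1 hxy a b habc
  exact ⟨ha, hb, hc⟩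

theorem lifts_add (hτ : IsCollineation τ) (h : IndepMod E ![u, v, w]) (hu : Lifts τ u x)
    (hw : Lifts τ w z) (huv : Lifts τ (u + v) (x + y)) (hvw : Lifts τ (v + w) (y + z)) :
    Lifts τ (u + v + w) (x + y + z) := by
  have huvw : IndepMod E ![u, u + v, w] := h.add_middle
  have hxyz : IndepMod E ![x, x + y, z] := hτ.indepMod_triple hu huv hw huvw
  have hu_vw : IndepMod E ![u, v + w] := by
    simpa only [one_smul] using
      (h.rotate.smul_add_smul (a := 1) (b := 1)
        (by simpa only [one_smul] using hvw.notMem_left)).symm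
  obtain ⟨s, hs⟩ := exists_lifts τ huvw.rotate.pair.add_right.notMem_right
  obtain ⟨a, b, hab⟩ := hτ.exists_smul_add_smul_eq huv hw huvw.rotate.pair hs
  obtain ⟨c, d, hcd⟩ := hτ.exists_smul_add_smul_eq hu hvw hu_vw (add_assoc u v w ▸ hs)
  obtain ⟨-, had, hbd⟩ := indepMod_triple_iff.1 hxyz (d - c) (a - d) (b - d) <| by
    convert E.zero_mem using 1
    rw [← sub_eq_zero.2 (hab.trans hcd.symm)]
    module
  obtain rfl : s = d • (x + y + z) := by
    rw [← hab, sub_eq_zero.1 had, sub_eq_zero.1 hbd, smul_add d (x + y)]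
  have hd : d ≠ 0 := fun hd => hs.notMem_right (by simp [hd])
  simpa only [inv_smul_smul₀ hd] using hs.smul_right (inv_ne_zero hd)

theorem exists_normalized_lift (hτ : IsCollineation τ) (hv : Lifts τ v y)
    (h : IndepMod E ![v, w]) : ∃ z, Lifts τ w z ∧ Lifts τ (v + w) (y + z) := by
  obtain ⟨z, hz⟩ := exists_lifts τ h.notMem_right
  obtain ⟨s, hs⟩ := exists_lifts τ h.add_right.notMem_right
  obtain ⟨a, b, rfl⟩ := hτ.exists_smul_add_smul_eq hv hz h hs
  have ha : a ≠ 0 := fun ha => by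
    have hzs := hτ.indepMod_pair hz hs (add_comm w v ▸ h.symm.add_right)
    exact neg_ne_zero.2 one_ne_zero (indepMod_pair_iff.1 hzs b (-1) (by simp [ha])).2
  have hb : b ≠ 0 := fun hb => by
    have hys := hτ.indepMod_pair hv hs h.add_right
    exact neg_ne_zero.2 one_ne_zero (indepMod_pair_iff.1 hys a (-1) (by simp [hb])).2
  refine ⟨(a⁻¹ * b) • z, hz.smul_right (mul_ne_zero (inv_ne_zero ha) hb), ?_⟩
  simpa only [smul_add, inv_smul_smul₀ ha, mul_smul] using hs.smul_right (inv_ne_zero ha)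

theorem normalized_lift_unique (hτ : IsCollineation τ) (hv : Lifts τ v y)
    (h : IndepMod E ![v, w]) (hx : Lifts τ w x) (hvx : Lifts τ (v + w) (y + x))
    (hz : Lifts τ w z) (hvz : Lifts τ (v + w) (y + z)) : x = z := by
  obtain ⟨c, -, rfl⟩ := hx.eq_smul hz
  obtain ⟨d, -, hd⟩ := hvx.eq_smul hvz
  have hyx := (hτ.indepMod_pair hv hx h).linearIndependent_pair
  obtain ⟨hd1, hcd⟩ := hyx.eq_of_pair (s := 1) (t := c) (s' := d) (t' := d) <| by
    rwa [one_smul, ← smul_add]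
  rw [hcd, ← hd1, one_smul]

theorem normalized_lift_add (hτ : IsCollineation τ) (h : IndepMod E ![v, w, u])
    (hv : Lifts τ v y) (hw : Lifts τ w z) (hvw : Lifts τ (v + w) (y + z)) (hu : Lifts τ u x)
    (hvu : Lifts τ (v + u) (y + x)) :
    Lifts τ (w + u) (z + x) ∧ Lifts τ (v + (w + u)) (y + (z + x)) := by
  have hvwu : Lifts τ (v + (w + u)) (y + (z + x)) := by
    have hwv : IndepMod E ![w, v, u] := by
      refine indepMod_triple_iff.2 fun a b c habc => ?_
      have := indepMod_triple_iff.1 h b a c (by convert habc using 1; module)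
      grind
    convert hτ.lifts_add hwv hw hu (add_comm v w ▸ add_comm y z ▸ hvw) hvu using 1 <;> abel
  refine ⟨?_, hvwu⟩
  have hneg : IndepMod E ![-v, v + w, u] := by
    refine indepMod_triple_iff.2 fun a b c habc => ?_
    have := indepMod_triple_iff.1 h (b - a) b c (by convert habc using 1; module)
    grind
  convert hτ.lifts_add (y := y + z) hneg hv.neg hu (by simpa using hw)
    (by simpa only [add_assoc] using hvwu) using 1 <;> abel

theorem exists_addMonoidHom_lifts_of_notMem_sup (hτ : IsCollineation τ) (hv : Lifts τ v y)
    (hW : ∀ x, ∃ z, z ∉ E ⊔ span F {v} ⊔ span F {x}) :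
    ∃ G : V →+ V, ∀ x ∉ E ⊔ span F {v}, Lifts τ x (G x) := by
  have hlift (x : V) : ∃ z, x ∉ E ⊔ span F {v} → Lifts τ x z ∧ Lifts τ (v + x) (y + z) := by
    by_cases hx : x ∈ E ⊔ span F {v}
    · exact ⟨0, fun h => absurd hx h⟩
    · exact (hτ.exists_normalized_lift hv (indepMod_pair_of_notMem hv.notMem_left hx)).imp
        fun _ hz _ => hz
  choose g hg using hlift
  obtain ⟨G, hG⟩ : ∃ G : V →+ V, ∀ x ∉ E ⊔ span F {v}, G x = g x := by
    refine exists_addMonoidHom_eq_of_notMem hW fun x z hxz => ?_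
    have hx := hg x hxz.notMem_left
    have hz := hg z hxz.notMem_right
    have hxz' : x + z ∉ E ⊔ span F {v} := hxz.add_right.notMem_right
    have hsum := hg (x + z) hxz'
    have hvxz : IndepMod E ![v, x, z] := hxz.of_sup_span_singleton hv.notMem_left
    have hadd := hτ.normalized_lift_add hvxz hv hx.1 hx.2 hz.1 hz.2
    exact hτ.normalized_lift_unique hv (indepMod_pair_of_notMem hv.notMem_left hxz') hsum.1 hsum.2
      hadd.1 hadd.2
  exact ⟨G, fun x hx => hG x hx ▸ (hg x hx).1⟩

theorem lifts_of_forall_notMem_lifts (hτ : IsCollineation τ) {W : Submodule F V} (hEW : E ≤ W)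
    (hW : ∀ x, ∃ z, z ∉ W ⊔ span F {x}) {G : V →+ V} (hG : ∀ x ∉ W, Lifts τ x (G x))
    (hx : x ∉ E) : Lifts τ x (G x) := by
  by_cases hxW : x ∈ W
  · have hEx : E ⊔ span F {x} ≤ W := sup_le hEW ((span_singleton_le_iff_mem _ _).2 hxW)
    obtain ⟨z, hz⟩ : ∃ z, z ∉ W := (hW 0).imp fun z hz h => hz (mem_sup_left h)
    obtain ⟨t, ht⟩ := hW z
    have htW : t ∉ W := fun h => ht (mem_sup_left h)
    have hxzt : IndepMod E ![x, z, t] := indepMod_triple_of_notMem hx (fun h => hz (hEx h))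
      fun h => ht (sup_le_sup_right hEx _ h)
    have hind : IndepMod E ![-t, x + z + t, -z] := by
      refine indepMod_triple_iff.2 fun a b c habc => ?_
      have := indepMod_triple_iff.1 hxzt b (b - c) (b - a) (by convert habc using 1; module)
      grind
    have hGxz := hG (x + z) fun h => hz ((add_mem_cancel_left hxW).1 h)
    have hGxt := hG (x + t) fun h => htW ((add_mem_cancel_left hxW).1 h)
    rw [map_add] at hGxz hGxt
    convert hτ.lifts_add (y := G x + G z + G t) hind (hG t htW).neg (hG z hz).neg
      (by convert hGxz using 1 <;> abel) (by convert hGxt using 1 <;> abel) using 1 <;> abel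
  · exact hG x hxW

theorem exists_addMonoidHom_lifts (hτ : IsCollineation τ) (hn : finrank F E + 2 < finrank F V) :
    ∃ G : V →+ V, ∀ x ∉ E, Lifts τ x (G x) := by
  obtain ⟨v, hv⟩ : ∃ v, v ∉ E := (exists_notMem_sup_span_singleton (by omega) 0).imp
    fun v hv h => hv (mem_sup_left h)
  obtain ⟨y, hy⟩ := exists_lifts τ hv
  have hW := exists_notMem_sup_span_singleton (E := E ⊔ span F {v})
    (by rwa [finrank_sup_span_singleton hv])
  obtain ⟨G, hG⟩ := hτ.exists_addMonoidHom_lifts_of_notMem_sup hy hW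
  exact ⟨G, fun x hx => hτ.lifts_of_forall_notMem_lifts le_sup_left hW hG hx⟩

end IsCollineation

end Lifts

section Semilinear

variable {F V : Type*} [Field F] [AddCommGroup V] [Module F V] {E : Submodule F V}
  {τ : Equiv.Perm (Transversal E 1)} {G : V →+ V} {v w x : V}

theorem injective_of_forall_lifts (hv : v ∉ E) (hG : ∀ x ∉ E, Lifts τ x (G x)) :
    Function.Injective G := by
  refine (injective_iff_map_eq_zero G).2 fun x hx => ?_
  have hxE : x ∈ E := by_contra fun hxE => (hG x hxE).notMem_right (hx ▸ E.zero_mem)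
  have hvx : Lifts τ (v + x) (G v) := by
    simpa only [map_add, hx, add_zero] using
      hG (v + x) fun h => hv ((add_mem_cancel_right hxE).1 h)
  obtain ⟨c, -, hc⟩ := (hG v hv).symm.eq_smul hvx.symm
  have hcv : (c - 1) • v ∈ E := by rwa [sub_smul, one_smul, ← hc, add_sub_cancel_left]
  have hc1 : c - 1 = 0 := by_contra fun hc1 => hv ((smul_mem_iff E hc1).1 hcv)
  rwa [sub_eq_zero.1 hc1, one_smul, add_eq_left] at hc

theorem surjective_of_forall_lifts (hv : v ∉ E) (hG : ∀ x ∉ E, Lifts τ x (G x)) {φ : F →+* F}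
    (hφ : ∀ c x, G (c • x) = φ c • G x) (hφ_surj : Function.Surjective φ) :
    Function.Surjective G := by
  have exists_of_notMem (y : V) (hy : y ∉ E) : ∃ x, G x = y := by
    obtain ⟨x, hx⟩ := exists_lifts τ.symm hy
    obtain ⟨c, -, hc⟩ := (hG x hx.notMem_right).eq_smul hx.symm
    obtain ⟨d, rfl⟩ := hφ_surj c
    exact ⟨d • x, by rw [hφ, hc]⟩
  intro y
  by_cases hy : y ∈ E
  · obtain ⟨x, hx⟩ := exists_of_notMem v hv
    obtain ⟨z, hz⟩ := exists_of_notMem (v + y) fun h => hv ((add_mem_cancel_right hy).1 h)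
    exact ⟨z - x, by rw [map_sub, hx, hz, add_sub_cancel_left]⟩
  · exact exists_of_notMem y hy

theorem gammaL_smul_sup (g : GammaL F V) (P Q : Submodule F V) : g • (P ⊔ Q) = g • P ⊔ g • Q := by
  apply le_antisymm
  · rintro _ ⟨x, hx, rfl⟩
    obtain ⟨p, hp, q, hq, rfl⟩ := mem_sup.1 hx
    rw [g.2.1]
    exact add_mem (mem_sup_left ⟨p, hp, rfl⟩) (mem_sup_right ⟨q, hq, rfl⟩)
  · exact sup_le (Set.image_mono (le_sup_left : P ≤ P ⊔ Q))
      (Set.image_mono (le_sup_right : Q ≤ P ⊔ Q))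

theorem color_smul (g : PGammaL F V) (hg : g • E = E) (P Q : Submodule F V) :
    color E (g • P) (g • Q) = color E P Q := by
  have hsup : g • Q ⊔ E = g • (Q ⊔ E) := by
    obtain ⟨k, hk⟩ := exists_rep g
    rw [hk] at hg
    rw [hk, hk, gammaL_smul_sup, hg]
  rw [color, color, hsup, ← smul_inf, ← smul_inf, finrank_smul, finrank_smul]

variable [FiniteDimensional F V]

namespace IsCollineation

theorem exists_ringHom_map_smul (hτ : IsCollineation τ) (hn : finrank F E + 1 < finrank F V)
    (hv : v ∉ E) (hG : ∀ x ∉ E, Lifts τ x (G x)) :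
    ∃ φ : F →+* F, ∀ c x, G (c • x) = φ c • G x := by
  refine AttenuatedSpace.exists_ringHom_map_smul (fun c => ?_) (v := v)
    fun h => (hG v hv).notMem_right (h ▸ E.zero_mem)
  refine exists_forall_eq_smul (f := G.comp (DistribSMul.toAddMonoidHom V c))
    (exists_notMem_sup_span_singleton hn) (fun x hx => ?_) fun x y hxy =>
      (hτ.indepMod_pair (hG x hxy.notMem_left) (hG y hxy.notMem_right) hxy).linearIndependent_pair
  obtain rfl | hc := eq_or_ne c 0
  · exact ⟨0, by simp⟩
  · have hcx := hG (c • x) (mt (smul_mem_iff E hc).1 hx)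
    obtain ⟨s, -, hs⟩ := ((hG x hx).symm.smul_right hc).symm.eq_smul hcx
    exact ⟨s, hs⟩

theorem surjective_of_map_smul (hτ : IsCollineation τ) (hG : ∀ x ∉ E, Lifts τ x (G x))
    (hvw : IndepMod E ![v, w]) {φ : F →+* F} (hφ : ∀ c x, G (c • x) = φ c • G x) :
    Function.Surjective φ := by
  intro c
  have hv := hG v hvw.notMem_left
  have hw := hG w hvw.notMem_right
  have hGvw := hτ.indepMod_pair hv hw hvw
  have hc : G v + c • G w ∉ E := fun h =>
    one_ne_zero (indepMod_pair_iff.1 hGvw 1 c (by rwa [one_smul])).1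
  obtain ⟨t, ht⟩ := exists_lifts τ.symm hc
  obtain ⟨a, b, rfl⟩ := Submodule.mem_span_pair.1 <| hτ.symm.mem_span_pair hv.symm hw.symm hGvw
    ht (Submodule.mem_span_pair.2 ⟨1, c, by rw [one_smul]⟩)
  obtain ⟨d, hd, hGt⟩ := ht.symm.eq_smul (hG _ ht.notMem_right)
  obtain ⟨ha, hb⟩ := hGvw.linearIndependent_pair.eq_of_pair (s := φ a) (t := φ b) (s' := d)
    (t' := d * c) <| by rw [← hφ, ← hφ, ← map_add, hGt, smul_add, mul_smul]
  exact ⟨b / a, by rw [map_div₀, ha, hb, mul_div_cancel_left₀ _ hd]⟩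

/-- The fundamental theorem of projective geometry for the points outside `E`. -/
theorem exists_gammaL (hτ : IsCollineation τ) (hn : finrank F E + 2 < finrank F V) :
    ∃ g : GammaL F V, g • E = E ∧ ∀ x ∉ E, Lifts τ x ((g : Equiv.Perm V) x) := by
  obtain ⟨G, hG⟩ := hτ.exists_addMonoidHom_lifts hn
  have hn' : finrank F E + 1 < finrank F V := by omega
  obtain ⟨v, hv⟩ : ∃ v, v ∉ E := (exists_notMem_sup_span_singleton hn' 0).imp
    fun v hv h => hv (mem_sup_left h)
  obtain ⟨w, hw⟩ := exists_notMem_sup_span_singleton hn' v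
  obtain ⟨φ, hφ⟩ := hτ.exists_ringHom_map_smul hn' hv hG
  have hφ_surj := hτ.surjective_of_map_smul hG (indepMod_pair_of_notMem hv hw) hφ
  let g : GammaL F V :=
    ⟨Equiv.ofBijective G ⟨injective_of_forall_lifts hv hG,
      surjective_of_forall_lifts hv hG hφ hφ_surj⟩, map_add G,
      RingEquiv.ofBijective φ ⟨φ.injective, hφ_surj⟩, hφ⟩
  refine ⟨g, (Submodule.eq_of_le_of_finrank_eq (fun y hy => ?_) ?_).symm, hG⟩
  · obtain ⟨x, rfl⟩ := (g : Equiv.Perm V).surjective y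
    exact ⟨x, by_contra fun hx => (hG x hx).notMem_right hy, rfl⟩
  · exact (finrank_smul (QuotientGroup.mk g : GammaL F V ⧸ scalars F V) E).symm

end IsCollineation

theorem PermutesColors.exists_gammaL {m : ℕ} {σ : Equiv.Perm (Transversal E m)}
    (hσ : PermutesColors σ) (hE : E ≠ ⊥) (hm : 1 < m) (hn : m + finrank F E < finrank F V) :
    ∃ g : GammaL F V, g • E = E ∧ ∀ P, (σ P).1 = g • P.1 := by
  obtain ⟨k, rfl⟩ : ∃ k, m = k + 2 := ⟨m - 2, by omega⟩
  obtain ⟨τ, hτ, hτσ⟩ := (hσ.preservesAdj hE (by omega) hn).exists_collineation hE hn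
  obtain ⟨g, hgE, hg⟩ := hτ.exists_gammaL (by omega)
  refine ⟨g, hgE, fun P => (Submodule.eq_of_le_of_finrank_eq ?_ ?_).symm⟩
  · rintro _ ⟨x, hx, rfl⟩
    by_cases hxE : x ∈ E
    · have hg0 : (g : Equiv.Perm V) 0 = 0 := by simpa using g.2.1 0 0
      rw [P.2.eq_zero hx hxE, hg0]
      exact zero_mem _
    · obtain ⟨p, hp, hτp⟩ := hg x hxE
      rw [← span_singleton_le_iff_mem, ← hτp, ← hτσ, hp, span_singleton_le_iff_mem]
      exact hx
  · rw [(σ P).2.finrank_eq]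
    exact (finrank_smul (QuotientGroup.mk g : GammaL F V ⧸ scalars F V) P.1).trans P.2.finrank_eq

theorem exists_transversal_mem_notMem {m : ℕ} (hm : 0 < m) (hn : m + finrank F E < finrank F V)
    (hv : v ∉ E) (hx : x ∉ span F {v}) : ∃ P : Transversal E m, v ∈ P.1 ∧ x ∉ P.1 := by
  induction m, hm using Nat.le_induction with
  | base =>
    exact ⟨⟨_, isTransversal_span_singleton_iff.2 hv⟩, mem_span_singleton_self v, hx⟩
  | succ m _ ih =>
    obtain ⟨P, hvP, hxP⟩ := ih (by omega)
    obtain ⟨z, hz⟩ := exists_notMem_sup_span_singleton (E := P.1 ⊔ E)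
      (by rw [P.2.finrank_sup]; omega) x
    refine ⟨⟨_, P.2.sup_span_singleton fun h => hz (mem_sup_left h)⟩, mem_sup_left hvP,
      fun h => hxP ?_⟩
    have hmem : x ∈ (P.1 ⊔ span F {z}) ⊓ span F {x} := ⟨h, mem_span_singleton_self x⟩
    have hle : P.1 ⊔ span F {x} ≤ P.1 ⊔ E ⊔ span F {x} := sup_le_sup_right le_sup_left _
    rw [sup_span_singleton_inf fun h => hz (hle h)] at hmem
    exact hmem.1

theorem mem_scalars_of_smul_eq {m : ℕ} (hm : 0 < m) (hn : m + finrank F E < finrank F V)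
    {g : GammaL F V} (hg : ∀ P : Transversal E m, g • P.1 = P.1) : g ∈ scalars F V := by
  have hmul (x : V) (hx : x ∉ E) : ∃ s : F, (g : Equiv.Perm V) x = s • x := by
    by_contra! hne
    obtain ⟨P, hxP, hgx⟩ := exists_transversal_mem_notMem hm hn hx
      (x := (g : Equiv.Perm V) x) fun h => by
        obtain ⟨s, hs⟩ := mem_span_singleton.1 h
        exact hne s hs.symm
    exact hgx (hg P ▸ ⟨x, hxP, rfl⟩)
  obtain ⟨v, hv⟩ : ∃ v, v ∉ E := (exists_notMem_sup_span_singleton (by omega) 0).imp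
    fun v hv h => hv (mem_sup_left h)
  obtain ⟨s, hs⟩ := exists_forall_eq_smul (E := E) (G := AddMonoidHom.id V)
    (f := AddMonoidHom.mk' (g : Equiv.Perm V) g.2.1)
    (exists_notMem_sup_span_singleton (by omega)) hmul fun _ _ h => h.linearIndependent_pair
  have hs0 : s ≠ 0 := by
    rintro rfl
    have hgv : (g : Equiv.Perm V) v = (g : Equiv.Perm V) 0 :=
      (hs v).trans ((zero_smul F v).trans (hs 0 |>.trans (zero_smul F 0)).symm)
    exact hv ((g : Equiv.Perm V).injective hgv ▸ E.zero_mem)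
  exact ⟨Units.mk0 s hs0, hs⟩

end Semilinear

section Scheme

variable {F : Type*} [Field F] {n l m : ℕ}

theorem finrank_E : finrank F (E F n l) = l := by
  have hli : LinearIndependent F fun i : Fin l =>
      (Pi.single (Fin.natAdd n i) (1 : F) : Fin (n + l) → F) := by
    simpa only [Function.comp_def, Pi.basisFun_apply] using
      (Pi.basisFun F (Fin (n + l))).linearIndependent.comp _ (Fin.natAdd_injective l n)
  rw [E, finrank_span_eq_card hli, Fintype.card_fin]

theorem E_ne_bot (hl : 0 < l) : E F n l ≠ ⊥ := by
  rw [← Submodule.one_le_finrank_iff, finrank_E]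
  exact hl

theorem ker_funLeft_castAdd :
    LinearMap.ker (LinearMap.funLeft F F (Fin.castAdd l : Fin n → Fin (n + l))) = E F n l := by
  have hle : E F n l ≤ LinearMap.ker (LinearMap.funLeft F F (Fin.castAdd l)) := by
    rw [E, span_le]
    rintro _ ⟨i, rfl⟩
    ext j
    have hne : Fin.castAdd l j ≠ Fin.natAdd n i :=
      Fin.ne_of_lt (j.2.trans_le (Nat.le_add_right n i))
    exact Pi.single_eq_of_ne hne _
  have hrank := LinearMap.finrank_range_add_finrank_ker
    (LinearMap.funLeft F F (Fin.castAdd l : Fin n → Fin (n + l)))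
  rw [LinearMap.range_eq_top.2 (LinearMap.funLeft_surjective_of_injective _ _ _
    (Fin.castAdd_injective n l)), finrank_top, finrank_fin_fun, finrank_fin_fun,
    Nat.add_left_cancel_iff] at hrank
  exact (Submodule.eq_of_le_of_finrank_eq hle (finrank_E.trans hrank.symm)).symm

theorem isType_zero_iff (P : Submodule F (Fin (n + l) → F)) :
    IsType m 0 P ↔ IsTransversal (E F n l) m P := by
  rw [IsType, Submodule.finrank_eq_zero, ← disjoint_iff]
  exact ⟨fun h => ⟨h.1, h.2⟩, fun h => ⟨h.1, h.2⟩⟩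

/-- The vertices of the scheme, as the transversal subspaces to which the abstract results on
`Transversal` apply. -/
def vertexEquiv : Vertex F n l m ≃ Transversal (E F n l) m :=
  Equiv.subtypeEquivRight isType_zero_iff

theorem finrank_front {P : Submodule F (Fin (n + l) → F)} (hP : Disjoint P (E F n l)) :
    finrank F (front P) = finrank F P := by
  rw [front, ← LinearMap.range_domRestrict]
  refine LinearMap.finrank_range_of_inj (LinearMap.ker_eq_bot.1 ?_)
  rw [LinearMap.ker_domRestrict, ker_funLeft_castAdd]
  exact disjoint_iff_comap_eq_bot.1 hP

theorem finrank_front_inf {P : Submodule F (Fin (n + l) → F)} (hP : Disjoint P (E F n l))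
    (Q : Submodule F (Fin (n + l) → F)) :
    finrank F ↥(front P ⊓ front Q) = finrank F ↥(P ⊓ (Q ⊔ E F n l)) := by
  rw [← finrank_front (hP.mono_left inf_le_left), front, front, front, map_inf_eq_map_inf_comap,
    comap_map_eq, ker_funLeft_castAdd]

theorem rel_iff_color {p : Index n l m} {P Q : Vertex F n l m} :
    rel F n l m p P Q ↔ (color (E F n l) P.1 Q.1).1 + p.1.1 = m ∧
      (color (E F n l) P.1 Q.1).2 + p.1.2 = m := by
  rw [rel, finrank_front_inf ((isType_zero_iff _).1 P.2).disjoint]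
  rfl

theorem rel_congr {p : Index n l m} {P Q R S : Vertex F n l m}
    (h : color (E F n l) P.1 Q.1 = color (E F n l) R.1 S.1) :
    rel F n l m p P Q ↔ rel F n l m p R S := by
  rw [rel_iff_color, rel_iff_color, h]

theorem color_eq_of_rel {p : Index n l m} {P Q R S : Vertex F n l m}
    (hPQ : rel F n l m p P Q) (hRS : rel F n l m p R S) :
    color (E F n l) P.1 Q.1 = color (E F n l) R.1 S.1 := by
  rw [rel_iff_color] at hPQ hRS
  apply Prod.ext <;> omega

theorem exists_rel (P Q : Vertex F n l m) : ∃ p, rel F n l m p P Q := by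
  obtain ⟨P, hP⟩ := P
  obtain ⟨Q, hQ⟩ := Q
  have hPt := (isType_zero_iff _).1 hP
  have hQt := (isType_zero_iff _).1 hQ
  have hmono : finrank F ↥(P ⊓ Q) ≤ finrank F ↥(P ⊓ (Q ⊔ E F n l)) :=
    finrank_mono (inf_le_inf_left _ le_sup_left)
  have hle : finrank F ↥(P ⊓ (Q ⊔ E F n l)) ≤ m :=
    (finrank_mono inf_le_left).trans hPt.finrank_eq.le
  have hadd_l : finrank F ↥(P ⊓ (Q ⊔ E F n l)) ≤ finrank F ↥(P ⊓ Q) + l :=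
    (finrank_inf_sup_le P Q _).trans_eq (by rw [finrank_E])
  have hadd_n : 2 * m ≤ n + finrank F ↥(P ⊓ (Q ⊔ E F n l)) := by
    have hsup_inf := finrank_sup_add_finrank_inf_eq P (Q ⊔ E F n l)
    have hsup := (P ⊔ (Q ⊔ E F n l)).finrank_le
    rw [hPt.finrank_eq, hQt.finrank_sup, finrank_E] at hsup_inf
    rw [finrank_fin_fun] at hsup
    omega
  refine ⟨⟨(m - finrank F ↥(P ⊓ (Q ⊔ E F n l)), m - finrank F ↥(P ⊓ Q)), ?_⟩, ?_⟩
  · dsimp only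
    omega
  · exact rel_iff_color.2 ⟨Nat.add_sub_of_le hle, Nat.add_sub_of_le (hmono.trans hle)⟩

theorem permutesColors_of_mem_schemeAut {σ : Equiv.Perm (Vertex F n l m)}
    (hσ : σ ∈ schemeAut (rel F n l m)) : PermutesColors (vertexEquiv.permCongr σ) := by
  suffices h : ∀ P Q R S : Vertex F n l m, color (E F n l) P.1 Q.1 = color (E F n l) R.1 S.1 ↔
      color (E F n l) (σ P).1 (σ Q).1 = color (E F n l) (σ R).1 (σ S).1 from
    fun P Q R S => h (vertexEquiv.symm P) (vertexEquiv.symm Q) (vertexEquiv.symm R)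
      (vertexEquiv.symm S)
  obtain ⟨π, hπ⟩ := hσ
  refine fun P Q R S => ⟨fun h => ?_, fun h => ?_⟩
  · obtain ⟨p, hp⟩ := exists_rel P Q
    exact color_eq_of_rel ((hπ _ _ _).1 hp) ((hπ _ _ _).1 ((rel_congr h).1 hp))
  · obtain ⟨p, hp⟩ := exists_rel (σ P) (σ Q)
    obtain ⟨p, rfl⟩ := π.surjective p
    exact color_eq_of_rel ((hπ _ _ _).2 hp) ((hπ _ _ _).2 ((rel_congr h).1 hp))

theorem toPermHom_mem_schemeAut (g : PGammaLStab F n l) :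
    MulAction.toPermHom (PGammaLStab F n l) (Vertex F n l m) g ∈ schemeAut (rel F n l m) :=
  ⟨1, fun _ P Q => rel_congr (P := P) (Q := Q) (R := g • P) (S := g • Q)
    (color_smul g.1 g.2 P.1 Q.1).symm⟩

theorem injective_toPermHom (hm : 0 < m) (hmn : m < n) :
    Function.Injective (MulAction.toPermHom (PGammaLStab F n l) (Vertex F n l m)) := by
  rw [injective_iff_map_eq_one]
  rintro ⟨g, hg⟩ hg_one
  obtain ⟨k, rfl⟩ := QuotientGroup.mk_surjective g
  refine Subtype.ext ((QuotientGroup.eq_one_iff k).2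
    (mem_scalars_of_smul_eq (E := E F n l) hm ?_ fun P => ?_))
  · rwa [finrank_E, finrank_fin_fun, Nat.add_lt_add_iff_right]
  · exact congrArg Subtype.val (DFunLike.congr_fun hg_one (vertexEquiv.symm P))

theorem exists_toPermHom_eq (hm : 1 < m) (hmn : m < n) (hl : 0 < l)
    {σ : Equiv.Perm (Vertex F n l m)} (hσ : σ ∈ schemeAut (rel F n l m)) :
    ∃ g, MulAction.toPermHom (PGammaLStab F n l) (Vertex F n l m) g = σ := by
  obtain ⟨g, hgE, hg⟩ := (permutesColors_of_mem_schemeAut hσ).exists_gammaL (E_ne_bot hl) hm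
    (by rwa [finrank_E, finrank_fin_fun, Nat.add_lt_add_iff_right])
  exact ⟨⟨(QuotientGroup.mk g : GammaL F (Fin (n + l) → F) ⧸ scalars F _), hgE⟩,
    Equiv.ext fun P => Subtype.ext (hg (vertexEquiv P)).symm⟩

end Scheme

end AttenuatedSpace

theorem theorem1p3_general {F : Type*} [Field F] (n l m : ℕ)
    (hm : 1 < m) (hmn : m < n) (hl : 0 < l) :
    Function.Injective (MulAction.toPermHom (AttenuatedSpace.PGammaLStab F n l)
      (AttenuatedSpace.Vertex F n l m)) ∧
    (MulAction.toPermHom (AttenuatedSpace.PGammaLStab F n l)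
      (AttenuatedSpace.Vertex F n l m)).range =
      AttenuatedSpace.schemeAut (AttenuatedSpace.rel F n l m) := by
  refine ⟨AttenuatedSpace.injective_toPermHom (by omega) hmn, le_antisymm ?_ fun σ hσ => ?_⟩
  · rintro _ ⟨g, rfl⟩
    exact AttenuatedSpace.toPermHom_mem_schemeAut g
  · exact AttenuatedSpace.exists_toPermHom_eq hm hmn hl hσ

/-- The action of the stabilizer of `E` in the projective semilinear group on the set of subspaces
of type `(m, 0)` identifies this stabilizer with the full automorphism group of the scheme:
the action is faithful, and its permutations are exactly the automorphisms. -/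
theorem theorem1p3 {F : Type*} [Field F] [Finite F] (n l m : ℕ)
    (hm : 1 < m) (hmn : m + 1 < n) (hl : 0 < l) :
    Function.Injective (MulAction.toPermHom (AttenuatedSpace.PGammaLStab F n l)
      (AttenuatedSpace.Vertex F n l m)) ∧
    (MulAction.toPermHom (AttenuatedSpace.PGammaLStab F n l)
      (AttenuatedSpace.Vertex F n l m)).range =
      AttenuatedSpace.schemeAut (AttenuatedSpace.rel F n l m) :=
  theorem1p3_general n l m hm (by omega) hl
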